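/- Write $e(x)=\exp(2\pi i x)$. For $\nu\in\mathbb{R}$, $m\in\mathbb{Z}$ and $z\in\mathbb{C}^{\times}$ let $\chi_{i\nu,m}(z)=|z|^{2i\nu}(z/|z|)^m$, and let $d\mu(\nu,m)$ be the product of Lebesgue measure on $\mathbb{R}$ and counting measure on $\mathbb{Z}$. For $f\in C_c^\infty(\mathbb{C}^\times)$ let $$\breve f(\nu,m)=\int_{\mathbb{C}^\times} f(z)\,\chi_{i\nu,m}(z)\,d^\times z,\qquad d^\times z=\frac{2\,dx\,dy}{|z|^2}\quad(z=x+iy).$$ Fix a smooth function $v:(0,\infty)\to\mathbb{R}$ with $v\equiv 1$ on $[1/2,2]$ and $v\equiv 0$ on $(0,1/3]\cup[3,\infty)$. For $R>0$ define $\xi_R(\nu,m)$ by letting $\xi_R(2\nu,m)$ be $\frac{1}{4\pi^2}$ times the Mellin transform at $(\nu,m)$ of $z\mapsto v(|z|/R)\,e(2\operatorname{Re} z)$. **Lemma.** There are constants $0<c_1<c_2$, depending only on $v$, such that for every $R_0>1$ the following hold. (1) For all $R\ge R_0$ and all $z\in\mathbb{C}$ with $|z|\in[R/2,2R]$, $$e(2\operatorname{Re}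 z)=\iint_{\mathbb{R}\times\mathbb{Z}}\xi_R(2\nu,m)\,\overline{\chi_{i\nu,m}(z)}\,d\mu(\nu,m),$$ where the integral converges absolutely. (2) For every real $A$ there is a constant $C$ depending only on $A$, $R_0$ and $v$ such that $|\xi_R(\nu,m)|\le C\,(R+|\nu|+|m|)^{-A}$ for all $R\ge R_0$, $\nu\in\mathbb{R}$ and $m\in\mathbb{Z}$, unless $c_1R\le\sqrt{\nu^2+m^2}\le c_2R$. (3) There is a constant $C$ depending only on $R_0$ and $v$ such that $|\xi_R(\nu,m)|\le C\,\dfrac{\log R}{R}$ for all $R\ge R_0$, $\nu\in\mathbb{R}$ and $m\in\mathbb{Z}$ with $c_1R\le\sqrt{\nu^2+m^2}\le c_2R$. -/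

import Mathlib

open MeasureTheory Set
open scoped ContDiff

noncomputable section

namespace ComplexMellin

/-- The additive exponential `e(x) = exp(2 π i x)`. -/
def e (x : ℝ) : ℂ := Complex.exp (2 * Real.pi * Complex.I * x)

/-- The unitary character `χ_{iν,m}(z) = |z|^{2iν} (z/|z|)^m` of `ℂˣ`. -/
def char (ν : ℝ) (m : ℤ) (z : ℂ) : ℂ :=
  (‖z‖ : ℂ) ^ (2 * Complex.I * (ν : ℂ)) * (z / (‖z‖ : ℂ)) ^ m

/-- The Mellin transform of a function on `ℂˣ`, with respect to the Haar measure
`d^×z = dz / |z|^2`, where `dz` is twice the Lebesgue measure of the plane. -/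
def mellinTransform (f : ℂ → ℂ) (ν : ℝ) (m : ℤ) : ℂ :=
  ∫ z : ℂ, f z * char ν m z * ((2 / ‖z‖ ^ 2 : ℝ) : ℂ)

/-- A smooth function on `(0, ∞)` that is `1` on `[1/2, 2]` and vanishes on
`(0, 1/3] ∪ [3, ∞)`. Its values outside `(0, ∞)` are irrelevant. -/
structure IsCutoff (v : ℝ → ℝ) : Prop where
  smooth : ContDiffOn ℝ ∞ v (Ioi 0)
  eq_one : ∀ x ∈ Icc (1 / 2 : ℝ) 2, v x = 1
  eq_zero : ∀ x ∈ Ioc (0 : ℝ) (1 / 3) ∪ Ici 3, v x = 0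

/-- The coefficient `ξ_R(ν, m)`, normalised so that `(ν, m) ↦ ξ_R(2ν, m)` is `1 / (4π²)` times the
Mellin transform of `v(|z|/R) e(2 Re z)`. -/
def xi (v : ℝ → ℝ) (R ν : ℝ) (m : ℤ) : ℂ :=
  ((1 / (4 * Real.pi ^ 2) : ℝ) : ℂ) *
    mellinTransform (fun z => (v (‖z‖ / R) : ℂ) * e (2 * z.re)) (ν / 2) m

/-- The measure on the unitary dual `ℝ × ℤ` of `ℂˣ`: Lebesgue measure times counting measure. -/
def dualMeasure : Measure (ℝ × ℤ) := (volume : Measure ℝ).prod Measure.count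

end ComplexMellin

end

/-! Everything rests on the Euler operator $E=z\,\partial/\partial z$. Since
$e(2\operatorname{Re}z)=\exp(2\pi iz)\exp(2\pi i\bar z)$ and the character is a power of $|z|$ times
$z^m$, the integrand `osc` satisfies $E\,\mathrm{osc}=D\cdot\mathrm{osc}$ with $D(z)=2\pi
iz+(i\nu+m)/2$. This one affine holomorphic function governs radial and angular oscillation
together; its only zero $z_0$ has $|z_0|=\sqrt{\nu^2+m^2}/(4\pi)$.

If $z_0$ is well away from the annulus $R/3\le|z|\le3R$, then $|D|\gg S=R+|\nu|+|m|$ there. Each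
integration by parts against $E$ gains $S^{-1}$, which gives (2) (`exists_norm_integral_osc_le`).

If $z_0$ may lie in the annulus, $1/D$ is replaced by $\bar D/(|D|^2+R)$. One integration by parts
leaves errors $O(R/(|D|^2+R))$; their integral over the annulus is $O(R\log(81R+1))$, and the weight
$|z|^{-2}\ll R^{-2}$ turns this into (3) (`IsBump.norm_integral_osc_le`).

For (1), polar coordinates make $\xi_R(\cdot,m)$ a Mellin transform in $r$ of the cutoff times the
$m$-th angular Fourier integral. Mellin inversion in $\nu$ and a Fourier series in $m$ recover the
function where the cutoff is 1. The bounds (2) and (3) supply absolute convergence, hence Fubini and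
the summability of the Fourier series. -/

namespace ComplexMellin

/-! ### Calculus of the Euler operator -/

/-- The Euler operator `z ∂/∂z`, with `∂/∂z` the Wirtinger derivative. -/
noncomputable def eulerDeriv (f : ℂ → ℂ) (z : ℂ) : ℂ :=
  z / 2 * (fderiv ℝ f z 1 - Complex.I * fderiv ℝ f z Complex.I)

/-- `f` is continuously differentiable near `z`, and its Euler derivative there is `f'`. -/
structure HasEulerDerivAt (f : ℂ → ℂ) (f' z : ℂ) : Prop where
  contDiffAt : ContDiffAt ℝ 1 f z
  eq : eulerDeriv f z = f'

namespace HasEulerDerivAt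

variable {f g : ℂ → ℂ} {f' g' z : ℂ}

lemma differentiableAt (hf : HasEulerDerivAt f f' z) : DifferentiableAt ℝ f z :=
  hf.contDiffAt.differentiableAt one_ne_zero

lemma mul (hf : HasEulerDerivAt f f' z) (hg : HasEulerDerivAt g g' z) :
    HasEulerDerivAt (fun x => f x * g x) (f' * g z + f z * g') z := by
  refine ⟨hf.contDiffAt.mul hg.contDiffAt, ?_⟩
  rw [eulerDeriv, fderiv_fun_mul hf.differentiableAt hg.differentiableAt, ← hf.eq, ← hg.eq]
  simp [eulerDeriv]
  ring

lemma comp_holomorphic {h : ℂ → ℂ} (hh : ContDiffAt ℂ 1 h (f z)) (hf : HasEulerDerivAt f f' z) :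
    HasEulerDerivAt (fun x => h (f x)) (deriv h (f z) * f') z := by
  refine ⟨(hh.restrict_scalars ℝ).comp z hf.contDiffAt, ?_⟩
  have h1 := ((hh.differentiableAt one_ne_zero).hasDerivAt.hasFDerivAt.restrictScalars ℝ).comp z
    hf.differentiableAt.hasFDerivAt
  have h2 : fderiv ℝ (fun x => h (f x)) z = _ := h1.fderiv
  rw [eulerDeriv, h2, ← hf.eq]
  simp [eulerDeriv]
  ring

lemma id (z : ℂ) : HasEulerDerivAt (fun x => x) z z := by
  refine ⟨contDiffAt_id, ?_⟩
  rw [eulerDeriv, fderiv_fun_id]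
  simp
  ring

/-- Antiholomorphic factors are constants for the operator; this is why only the holomorphic half of
the exponential contributes to the phase. -/
lemma conj (z : ℂ) : HasEulerDerivAt (fun x => (starRingEnd ℂ) x) 0 z := by
  have h : (fun x => (starRingEnd ℂ) x) = (Complex.conjCLE : ℂ → ℂ) := rfl
  refine ⟨h ▸ Complex.conjCLE.contDiff.contDiffAt, ?_⟩
  rw [eulerDeriv, h, ContinuousLinearEquiv.fderiv]
  simp

lemma radial {h : ℝ → ℂ} (hz : z ≠ 0) (hh : ContDiffAt ℝ 1 h ‖z‖) :
    HasEulerDerivAt (fun x => h ‖x‖) (‖z‖ / 2 * deriv h ‖z‖) z := by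
  refine ⟨hh.comp z (contDiffAt_norm ℝ hz), ?_⟩
  have hn : DifferentiableAt ℝ (fun x : ℂ => ‖x‖) z :=
    (contDiffAt_norm (n := 1) ℝ hz).differentiableAt one_ne_zero
  have hd (v : ℂ) : fderiv ℝ (fun x : ℂ => ‖x‖) z v = inner ℝ z v / ‖z‖ := by
    have h1 := (hn.hasFDerivAt.pow 2)
    have h2 := (hasStrictFDerivAt_norm_sq z).hasFDerivAt
    have h3 := congrArg (fun L => L v) (h1.unique h2)
    have h4 : ‖z‖ ≠ 0 := norm_ne_zero_iff.2 hz
    simp at h3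
    field_simp
    simp
    linarith
  have h1 := (hh.differentiableAt one_ne_zero).hasDerivAt.hasFDerivAt.comp z hn.hasFDerivAt
  have h2 : fderiv ℝ (fun x => h ‖x‖) z = _ := h1.fderiv
  rw [eulerDeriv, h2]
  have h4 : (‖z‖ : ℂ) ≠ 0 := by simpa using hz
  have h5 : (‖z‖ : ℂ) ^ 2 = z * (z.re - Complex.I * z.im) := by
    rw [← Complex.ofReal_pow, Complex.sq_norm, Complex.normSq_apply]
    apply Complex.ext <;> simp <;> ring
  simp [hd, Complex.inner]
  field_simp
  rw [h5]
  ring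

lemma congr_deriv (hf : HasEulerDerivAt f f' z) (h : f' = g') : HasEulerDerivAt f g' z := h ▸ hf

end HasEulerDerivAt

/-! ### Integration by parts on annuli -/

lemma integral_fderiv_apply_eq_zero {G : ℂ → ℂ} (hG : ContDiff ℝ 1 G) (hc : HasCompactSupport G)
    (v : ℂ) : ∫ z, fderiv ℝ G z v = 0 := by
  have hi : Integrable (fun z => fderiv ℝ G z v) :=
    ((hG.continuous_fderiv one_ne_zero).clm_apply continuous_const).integrable_of_hasCompactSupport
      (hc.fderiv_apply (𝕜 := ℝ) v)
  have := integral_mul_fderiv_eq_neg_fderiv_mul_of_integrable (μ := volume) (f := fun _ : ℂ => (1 : ℂ))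
    (g := G) (v := v) (by simp) (by simpa using hi)
    (by simpa using hG.continuous.integrable_of_hasCompactSupport hc)
    (fun x _ => by fun_prop) (fun x _ => hG.differentiable one_ne_zero x)
  simpa using this

/-- Because $1/\bar z$ is antiholomorphic, $|z|^{-2}z\,\partial_zG=\partial_z(G/\bar z)$ is an exact
derivative. Vanishing of $G$ near 0 keeps $G/\bar z$ continuously differentiable. -/
lemma integral_eulerDeriv_eq_zero {G : ℂ → ℂ} {r : ℝ} (hr : 0 < r) (hG : ContDiff ℝ 1 G)
    (h0 : ∀ z, ‖z‖ < r → G z = 0) (hc : HasCompactSupport G) :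
    ∫ z, eulerDeriv G z / (‖z‖ : ℂ) ^ 2 = 0 := by
  set H : ℂ → ℂ := fun z => G z * ((starRingEnd ℂ) z)⁻¹ with hH
  have hH0 : ∀ z, ‖z‖ < r → H =ᶠ[nhds z] 0 := by
    intro z hz
    filter_upwards [(isOpen_lt continuous_norm continuous_const).mem_nhds hz] with x hx
    simp [hH, h0 x hx]
  have hinv (z : ℂ) (hz : z ≠ 0) : HasEulerDerivAt (fun x => ((starRingEnd ℂ) x)⁻¹) 0 z := by
    have h1 : ContDiffAt ℂ 1 (fun x : ℂ => x⁻¹) ((starRingEnd ℂ) z) :=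
      contDiffAt_inv ℂ (by simpa using hz)
    exact ((HasEulerDerivAt.conj z).comp_holomorphic h1).congr_deriv (by simp)
  have hHE (z : ℂ) (hz : z ≠ 0) :
      HasEulerDerivAt H (eulerDeriv G z * ((starRingEnd ℂ) z)⁻¹) z :=
    (HasEulerDerivAt.mul ⟨hG.contDiffAt, rfl⟩ (hinv z hz)).congr_deriv (by simp)
  have hHd : ContDiff ℝ 1 H := by
    rw [contDiff_iff_contDiffAt]
    intro z
    by_cases hz : z = 0
    · exact (contDiffAt_const (c := (0 : ℂ))).congr_of_eventuallyEq (hH0 z (by simpa [hz] using hr))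
    · exact (hHE z hz).contDiffAt
  have hHc : HasCompactSupport H := hc.mul_right
  have hi (v : ℂ) : Integrable (fun z => fderiv ℝ H z v) :=
    ((hHd.continuous_fderiv one_ne_zero).clm_apply continuous_const).integrable_of_hasCompactSupport
      (hHc.fderiv_apply (𝕜 := ℝ) v)
  have key (z : ℂ) : eulerDeriv G z / (‖z‖ : ℂ) ^ 2 =
      1 / 2 * (fderiv ℝ H z 1 - Complex.I * fderiv ℝ H z Complex.I) := by
    by_cases hz : z = 0
    · rw [(hH0 z (by simpa [hz] using hr)).fderiv_eq]
      simp [hz]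
    · have h1 := (hHE z hz).eq
      rw [eulerDeriv] at h1
      have h2 : (‖z‖ : ℂ) ^ 2 = z * (starRingEnd ℂ) z := (Complex.mul_conj' z).symm
      have h3 : (starRingEnd ℂ) z ≠ 0 := by simpa using hz
      rw [h2, div_eq_iff (by simp [hz]),
        show eulerDeriv G z = eulerDeriv G z * ((starRingEnd ℂ) z)⁻¹ * (starRingEnd ℂ) z by
          field_simp, ← h1]
      ring
  simp_rw [key]
  rw [integral_const_mul, integral_sub (hi 1) ((hi _).const_mul _), integral_const_mul,
    integral_fderiv_apply_eq_zero hHd hHc, integral_fderiv_apply_eq_zero hHd hHc]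
  simp

/-- A smooth function on the line that vanishes off `[1/3, 3]`. -/
structure IsBump (w : ℝ → ℂ) : Prop where
  smooth : ContDiff ℝ ∞ w
  eq_zero : ∀ x ∉ Icc (1 / 3 : ℝ) 3, w x = 0

/-- The operator `x d/dx`. -/
noncomputable def radialDeriv (w : ℝ → ℂ) (x : ℝ) : ℂ := x * deriv w x

namespace IsBump

variable {w : ℝ → ℂ}

lemma isBump_radialDeriv (hw : IsBump w) : IsBump (radialDeriv w) := by
  constructor
  · have h1 : ContDiff ℝ ∞ (deriv w) := (contDiff_infty_iff_deriv.1 hw.smooth).2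
    exact Complex.ofRealCLM.contDiff.mul h1
  · intro x hx
    have : w =ᶠ[nhds x] fun _ => 0 := by
      filter_upwards [isClosed_Icc.isOpen_compl.mem_nhds hx] with y hy using hw.eq_zero y hy
    simp [radialDeriv, this.deriv_eq]

lemma exists_norm_le (hw : IsBump w) : ∃ M, 0 < M ∧ ∀ x, ‖w x‖ ≤ M := by
  obtain ⟨M, hM⟩ := (isCompact_Icc (a := (1 / 3 : ℝ)) (b := 3)).exists_bound_of_continuousOn
    hw.smooth.continuous.continuousOn
  refine ⟨max M 1, by positivity, fun x => ?_⟩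
  by_cases hx : x ∈ Icc (1 / 3 : ℝ) 3
  · exact (hM x hx).trans (le_max_left _ _)
  · simp [hw.eq_zero x hx]

end IsBump

/-- The closed annulus `R / 3 ≤ |z| ≤ 3 R`. -/
def annulus (R : ℝ) : Set ℂ := {z | ‖z‖ ∈ Icc (R / 3) (3 * R)}

lemma isClosed_annulus (R : ℝ) : IsClosed (annulus R) := isClosed_Icc.preimage continuous_norm

lemma isCompact_annulus (R : ℝ) : IsCompact (annulus R) :=
  Metric.isCompact_of_isClosed_isBounded (isClosed_annulus R)
    (Metric.isBounded_closedBall (x := (0 : ℂ)) (r := 3 * R) |>.subset fun z hz => by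
      simpa using hz.2)

lemma mem_annulus_iff {R : ℝ} (hR : 0 < R) {z : ℂ} :
    z ∈ annulus R ↔ ‖z‖ / R ∈ Icc (1 / 3 : ℝ) 3 := by
  simp only [annulus, mem_ofPred_eq, mem_Icc]
  rw [le_div_iff₀ hR, div_le_iff₀ hR, one_div, inv_mul_eq_div]

lemma ne_zero_of_mem_annulus {R : ℝ} (hR : 0 < R) {z : ℂ} (hz : z ∈ annulus R) : z ≠ 0 := by
  rintro rfl
  have := hz.1
  simp at this
  linarith

section IntegrationByParts

variable {w : ℝ → ℂ} {R : ℝ} {F F' : ℂ → ℂ}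

lemma IsBump.apply_eq_zero (hw : IsBump w) (hR : 0 < R) {z : ℂ} (hz : z ∉ annulus R) :
    w (‖z‖ / R) = 0 := hw.eq_zero _ (by rwa [← mem_annulus_iff hR])

lemma IsBump.eventuallyEq_zero (hw : IsBump w) (hR : 0 < R) {z : ℂ} (hz : z ∉ annulus R) :
    (fun x => w (‖x‖ / R) * F x) =ᶠ[nhds z] fun _ => 0 := by
  filter_upwards [(isClosed_annulus R).isOpen_compl.mem_nhds hz] with x hx
  simp [hw.apply_eq_zero hR hx]

lemma IsBump.hasEulerDerivAt (hw : IsBump w) (hR : 0 < R) {z : ℂ} (hz : z ∈ annulus R) :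
    HasEulerDerivAt (fun x => w (‖x‖ / R)) (1 / 2 * radialDeriv w (‖z‖ / R)) z := by
  have h1 : ContDiff ℝ 1 (fun r => w (r / R)) :=
    (hw.smooth.of_le (by simp)).comp (contDiff_id.div_const R)
  refine (HasEulerDerivAt.radial (ne_zero_of_mem_annulus hR hz) h1.contDiffAt).congr_deriv ?_
  have h2 : HasDerivAt (fun r => w (r / R)) ((1 / R) • deriv w (‖z‖ / R)) ‖z‖ :=
    HasDerivAt.scomp (h := fun r : ℝ => r / R) ‖z‖
      (hw.smooth.differentiable (by simp) _).hasDerivAt ((hasDerivAt_id _).div_const R)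
  rw [h2.deriv]
  simp [radialDeriv]
  ring

lemma IsBump.integrable (hw : IsBump w) (hR : 0 < R) (hF : ∀ z ∈ annulus R, ContinuousAt F z) :
    Integrable (fun z => w (‖z‖ / R) * F z) := by
  refine Continuous.integrable_of_hasCompactSupport ?_ ?_
  · rw [continuous_iff_continuousAt]
    intro z
    by_cases hz : z ∈ annulus R
    · have h1 : Continuous fun z : ℂ => w (‖z‖ / R) :=
        hw.smooth.continuous.comp (continuous_norm.div_const R)
      exact h1.continuousAt.mul (hF z hz)
    · exact (continuousAt_const).congr (hw.eventuallyEq_zero hR hz).symm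
  · exact HasCompactSupport.intro (isCompact_annulus R)
      fun z hz => by simp [hw.apply_eq_zero hR hz]

lemma IsBump.integrable_div (hw : IsBump w) (hR : 0 < R)
    (hF : ∀ z ∈ annulus R, ContinuousAt F z) :
    Integrable (fun z => w (‖z‖ / R) * F z / (‖z‖ : ℂ) ^ 2) := by
  simp_rw [mul_div_assoc]
  refine hw.integrable hR fun z hz => (hF z hz).div (by fun_prop) ?_
  simpa using ne_zero_of_mem_annulus hR hz

/-- Product rule plus the vanishing of the integral of an Euler derivative. The new weight
`radialDeriv w` is again a bump independent of $R$, so the step can be iterated with uniform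
constants. -/
lemma IsBump.integral_mul_eulerDeriv (hw : IsBump w) (hR : 0 < R)
    (hF : ∀ z ∈ annulus R, HasEulerDerivAt F (F' z) z)
    (hF' : ∀ z ∈ annulus R, ContinuousAt F' z) :
    ∫ z, w (‖z‖ / R) * F' z / (‖z‖ : ℂ) ^ 2 =
      -(1 / 2) * ∫ z, radialDeriv w (‖z‖ / R) * F z / (‖z‖ : ℂ) ^ 2 := by
  have hE (z : ℂ) (hz : z ∈ annulus R) := (hw.hasEulerDerivAt hR hz).mul (hF z hz)
  have hG : ContDiff ℝ 1 fun z => w (‖z‖ / R) * F z := by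
    rw [contDiff_iff_contDiffAt]
    intro z
    by_cases hz : z ∈ annulus R
    · exact (hE z hz).contDiffAt
    · exact contDiffAt_const.congr_of_eventuallyEq (hw.eventuallyEq_zero hR hz)
  have h0 := integral_eulerDeriv_eq_zero (r := R / 3) (by positivity) hG
    (fun z hz => by
      have : z ∉ annulus R := fun h => absurd h.1 (not_le.2 hz)
      simp [hw.apply_eq_zero hR this])
    (HasCompactSupport.intro (isCompact_annulus R)
      fun z hz => by simp [hw.apply_eq_zero hR hz])
  have h1 (z : ℂ) : eulerDeriv (fun z => w (‖z‖ / R) * F z) z / (‖z‖ : ℂ) ^ 2 =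
      1 / 2 * (radialDeriv w (‖z‖ / R) * F z / (‖z‖ : ℂ) ^ 2) +
        w (‖z‖ / R) * F' z / (‖z‖ : ℂ) ^ 2 := by
    by_cases hz : z ∈ annulus R
    · rw [(hE z hz).eq]
      ring
    · rw [eulerDeriv, (hw.eventuallyEq_zero hR hz).fderiv_eq, hw.isBump_radialDeriv.apply_eq_zero hR hz,
        hw.apply_eq_zero hR hz]
      simp
  simp_rw [h1] at h0
  rw [integral_add ((hw.isBump_radialDeriv.integrable_div hR
    fun z hz => (hF z hz).contDiffAt.continuousAt).const_mul _) (hw.integrable_div hR hF'),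
    integral_const_mul] at h0
  linear_combination h0

end IntegrationByParts

lemma IsBump.norm_integral_le {w : ℝ → ℂ} (hw : IsBump w) {M R : ℝ} (hM : ∀ x, ‖w x‖ ≤ M)
    (hR : 0 < R) {F : ℂ → ℂ} {B : ℂ → ℝ} (hF : ∀ z ∈ annulus R, ‖F z‖ ≤ B z)
    (hB : IntegrableOn B (annulus R)) :
    ‖∫ z, w (‖z‖ / R) * F z / (‖z‖ : ℂ) ^ 2‖ ≤ M * (9 / R ^ 2) * ∫ z in annulus R, B z := by
  have h0 : ∫ z, w (‖z‖ / R) * F z / (‖z‖ : ℂ) ^ 2 =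
      ∫ z in annulus R, w (‖z‖ / R) * F z / (‖z‖ : ℂ) ^ 2 := by
    rw [setIntegral_eq_integral_of_forall_compl_eq_zero]
    intro z hz
    simp [hw.apply_eq_zero hR hz]
  rw [h0, ← integral_const_mul]
  refine norm_integral_le_of_norm_le (hB.const_mul _) ?_
  refine (ae_restrict_iff' (isClosed_annulus R).measurableSet).2 (.of_forall fun z hz => ?_)
  have hz0 : 0 < ‖z‖ := norm_pos_iff.2 (ne_zero_of_mem_annulus hR hz)
  -- The 9 comes from $|z|\ge R/3$.
  have h1 : (‖z‖ ^ 2)⁻¹ ≤ 9 / R ^ 2 := by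
    rw [inv_le_comm₀ (by positivity) (by positivity), inv_div]
    have := hz.1
    nlinarith
  rw [norm_div, norm_mul, norm_pow, Complex.norm_real, norm_norm, div_eq_mul_inv]
  calc ‖w (‖z‖ / R)‖ * ‖F z‖ * (‖z‖ ^ 2)⁻¹ ≤ M * B z * (9 / R ^ 2) := by
        have hM0 := (norm_nonneg _).trans (hM 0)
        have hB0 := (norm_nonneg _).trans (hF z hz)
        gcongr
        · exact hM _
        · exact hF z hz
    _ = _ := by ring

lemma volume_real_annulus_le {R : ℝ} (hR : 0 < R) : volume.real (annulus R) ≤ 9 * Real.pi * R ^ 2 := by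
  have h1 : annulus R ⊆ Metric.closedBall (0 : ℂ) (3 * R) := fun z hz => by simpa using hz.2
  refine (measureReal_mono h1 (by simp [ENNReal.mul_eq_top, ENNReal.ofReal_ne_top])).trans ?_
  rw [measureReal_def, Complex.volume_closedBall, ENNReal.toReal_mul, ENNReal.toReal_pow,
    ENNReal.toReal_ofReal (by positivity)]
  simp
  nlinarith

lemma IsBump.norm_integral_le_of_norm_le_const {w : ℝ → ℂ} (hw : IsBump w) {M R K : ℝ}
    (hM : ∀ x, ‖w x‖ ≤ M) (hR : 0 < R) {F : ℂ → ℂ} (hF : ∀ z ∈ annulus R, ‖F z‖ ≤ K)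
    (hK : 0 ≤ K) :
    ‖∫ z, w (‖z‖ / R) * F z / (‖z‖ : ℂ) ^ 2‖ ≤ M * (81 * Real.pi) * K := by
  have hM0 := (norm_nonneg _).trans (hM 0)
  refine (hw.norm_integral_le hM hR (B := fun _ => K) hF
    (integrableOn_const (isCompact_annulus R).measure_lt_top.ne)).trans ?_
  rw [setIntegral_const, smul_eq_mul]
  calc M * (9 / R ^ 2) * (volume.real (annulus R) * K)
      ≤ M * (9 / R ^ 2) * (9 * Real.pi * R ^ 2 * K) := by
        gcongr
        exact volume_real_annulus_le hR
    _ = _ := by field_simp; ring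

/-! ### The oscillating factor and its phase -/

/-- The oscillating factor `e(2 Re z) χ_{iν/2,m}(z)` of the integral defining `ξ_R(ν, m)`. -/
noncomputable def osc (ν : ℝ) (m : ℤ) (z : ℂ) : ℂ := e (2 * z.re) * char (ν / 2) m z

/-- The logarithmic Euler derivative of `osc ν m`. -/
noncomputable def phaseDeriv (ν : ℝ) (m : ℤ) (z : ℂ) : ℂ :=
  2 * Real.pi * Complex.I * z + (Complex.I * ν + m) / 2

lemma norm_e (x : ℝ) : ‖e x‖ = 1 := by
  rw [e, show 2 * Real.pi * Complex.I * x = ((2 * Real.pi * x : ℝ) : ℂ) * Complex.I by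
    push_cast; ring, Complex.norm_exp_ofReal_mul_I]

lemma norm_char (ν : ℝ) (m : ℤ) {z : ℂ} (hz : z ≠ 0) : ‖char ν m z‖ = 1 := by
  have h : 0 < ‖z‖ := norm_pos_iff.2 hz
  rw [char, norm_mul, Complex.norm_cpow_eq_rpow_re_of_pos h, norm_zpow, norm_div]
  simp [h.ne']

lemma norm_osc (ν : ℝ) (m : ℤ) {z : ℂ} (hz : z ≠ 0) : ‖osc ν m z‖ = 1 := by
  rw [osc, norm_mul, norm_e, norm_char _ _ hz, one_mul]

lemma e_two_mul_re (z : ℂ) : e (2 * z.re) =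
    Complex.exp (2 * Real.pi * Complex.I * z) *
      Complex.exp (2 * Real.pi * Complex.I * (starRingEnd ℂ) z) := by
  rw [e, ← Complex.exp_add, ← mul_add, Complex.add_conj]

/-- Separates a radial factor from a holomorphic one, each of which is an eigenfunction of the Euler
operator. -/
lemma char_eq (ν : ℝ) (m : ℤ) {z : ℂ} (hz : z ≠ 0) :
    char ν m z = (‖z‖ : ℂ) ^ (2 * Complex.I * (ν : ℂ) - m) * z ^ m := by
  have h : (‖z‖ : ℂ) ≠ 0 := by simpa using hz
  rw [char, Complex.cpow_sub _ _ h, Complex.cpow_intCast, div_zpow]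
  ring

lemma hasEulerDerivAt_e (z : ℂ) :
    HasEulerDerivAt (fun x => e (2 * x.re)) (2 * Real.pi * Complex.I * z * e (2 * z.re)) z := by
  have hexp (x : ℂ) : ContDiffAt ℂ 1 (fun y => Complex.exp (2 * Real.pi * Complex.I * y)) x := by
    fun_prop
  have hd (x : ℂ) : deriv (fun y => Complex.exp (2 * Real.pi * Complex.I * y)) x =
      2 * Real.pi * Complex.I * Complex.exp (2 * Real.pi * Complex.I * x) := by
    have := (((hasDerivAt_id x).const_mul (2 * Real.pi * Complex.I)).cexp).deriv
    simp only [id] at this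
    rw [this]
    ring
  simp_rw [e_two_mul_re]
  refine (((HasEulerDerivAt.id z).comp_holomorphic (hexp _)).mul
    ((HasEulerDerivAt.conj z).comp_holomorphic (hexp _))).congr_deriv ?_
  rw [hd]
  ring

lemma hasEulerDerivAt_norm_cpow (c : ℂ) {z : ℂ} (hz : z ≠ 0) :
    HasEulerDerivAt (fun x => (‖x‖ : ℂ) ^ c) (c / 2 * (‖z‖ : ℂ) ^ c) z := by
  have h : (‖z‖ : ℂ) ≠ 0 := by simpa using hz
  have h0 : 0 < ‖z‖ := norm_pos_iff.2 hz
  have hs : (‖z‖ : ℂ) ∈ Complex.slitPlane := by simp [h0]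
  have h1 : ContDiffAt ℂ 1 (fun x : ℂ => x ^ c) (‖z‖ : ℂ) := by
    have : ContDiffAt ℂ 1 (fun x : ℂ => Complex.exp (Complex.log x * c)) (‖z‖ : ℂ) :=
      ((Complex.contDiffAt_log hs).mul contDiffAt_const).cexp
    refine this.congr_of_eventuallyEq ?_
    filter_upwards [isOpen_ne.mem_nhds h] with x hx
    exact Complex.cpow_def_of_ne_zero hx c
  have h2 : HasEulerDerivAt (fun x => (‖x‖ : ℂ)) (‖z‖ / 2) z := by
    refine (HasEulerDerivAt.radial (h := fun r => (r : ℂ)) hz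
      Complex.ofRealCLM.contDiff.contDiffAt).congr_deriv ?_
    have : deriv (fun r : ℝ => (r : ℂ)) ‖z‖ = 1 := Complex.ofRealCLM.hasDerivAt.deriv
    rw [this, mul_one]
  refine (h2.comp_holomorphic h1).congr_deriv ?_
  have h3 : deriv (fun x : ℂ => x ^ c) (‖z‖ : ℂ) = _ :=
    ((hasDerivAt_id (‖z‖ : ℂ)).cpow_const hs).deriv
  rw [h3, id, Complex.cpow_sub _ _ h]
  simp
  field_simp

lemma hasEulerDerivAt_zpow (m : ℤ) {z : ℂ} (hz : z ≠ 0) :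
    HasEulerDerivAt (fun x => x ^ m) (m * z ^ m) z := by
  have h1 : ContDiffAt ℂ 1 (fun x : ℂ => x ^ m) z :=
    (analyticAt_id.zpow hz).contDiffAt
  refine ((HasEulerDerivAt.id z).comp_holomorphic h1).congr_deriv ?_
  rw [deriv_zpow, zpow_sub_one₀ hz]
  field_simp

lemma hasEulerDerivAt_osc (ν : ℝ) (m : ℤ) {z : ℂ} (hz : z ≠ 0) :
    HasEulerDerivAt (osc ν m) (phaseDeriv ν m z * osc ν m z) z := by
  have h1 := (hasEulerDerivAt_e z).mul
    ((hasEulerDerivAt_norm_cpow (2 * Complex.I * ((ν / 2 : ℝ) : ℂ) - m) hz).mul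
      (hasEulerDerivAt_zpow m hz))
  have h2 : osc ν m =ᶠ[nhds z] fun x => e (2 * x.re) *
      ((‖x‖ : ℂ) ^ (2 * Complex.I * ((ν / 2 : ℝ) : ℂ) - m) * x ^ m) := by
    filter_upwards [isOpen_ne.mem_nhds hz] with x hx
    rw [osc, char_eq _ _ hx]
  refine ⟨h1.contDiffAt.congr_of_eventuallyEq h2, ?_⟩
  have h3 := h1.eq
  rw [eulerDeriv] at h3 ⊢
  rw [h2.fderiv_eq, h3, h2.eq_of_nhds, phaseDeriv]
  push_cast
  ring

/-- The cutoff `v`, extended by zero to the line. -/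
noncomputable def extendZero (v : ℝ → ℝ) (x : ℝ) : ℂ := if 0 < x then (v x : ℂ) else 0

lemma IsCutoff.isBump {v : ℝ → ℝ} (hv : IsCutoff v) : IsBump (extendZero v) := by
  have h0 : ∀ x < (1 / 3 : ℝ), extendZero v x = 0 := by
    intro x hx
    by_cases h : 0 < x
    · simp [extendZero, hv.eq_zero x (Or.inl ⟨h, hx.le⟩)]
    · simp [extendZero, h]
  constructor
  · rw [contDiff_iff_contDiffAt]
    intro x
    by_cases hx : x < 1 / 3
    · refine (contDiffAt_const (c := (0 : ℂ))).congr_of_eventuallyEq ?_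
      filter_upwards [isOpen_Iio.mem_nhds hx] with y hy using h0 y hy
    · have hx0 : 0 < x := by linarith
      refine (Complex.ofRealCLM.contDiff.contDiffAt.comp x
        (hv.smooth.contDiffAt (isOpen_Ioi.mem_nhds hx0))).congr_of_eventuallyEq ?_
      filter_upwards [isOpen_Ioi.mem_nhds hx0] with y hy
      simp [extendZero, mem_Ioi.1 hy]
  · intro x hx
    rcases lt_or_ge x (1 / 3) with h | h
    · exact h0 x h
    · have h3 : 3 < x := by
        by_contra h'
        exact hx ⟨h, not_lt.1 h'⟩
      simp [extendZero, hv.eq_zero x (Or.inr h3.le)]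

/-- The 2 in the Haar measure turns $1/(4\pi^2)$ into $1/(2\pi^2)$. At $z=0$ both integrands vanish,
since division by zero gives zero. -/
lemma xi_eq (v : ℝ → ℝ) {R : ℝ} (hR : 0 < R) (ν : ℝ) (m : ℤ) :
    xi v R ν m = (1 / (2 * Real.pi ^ 2)) *
      ∫ z, extendZero v (‖z‖ / R) * osc ν m z / (‖z‖ : ℂ) ^ 2 := by
  have h (z : ℂ) : (v (‖z‖ / R) : ℂ) * e (2 * z.re) * char (ν / 2) m z * ((2 / ‖z‖ ^ 2 : ℝ) : ℂ) =
      2 * (extendZero v (‖z‖ / R) * osc ν m z / (‖z‖ : ℂ) ^ 2) := by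
    by_cases hz : z = 0
    · simp [hz]
    · have : 0 < ‖z‖ / R := by positivity
      simp only [extendZero, this, if_true, osc]
      push_cast
      ring
  simp_rw [xi, mellinTransform, h]
  rw [integral_const_mul]
  push_cast
  field_simp
  ring

lemma norm_mul_add_half (ν m : ℝ) : ‖(Complex.I * ν + m) / 2‖ = Real.sqrt (ν ^ 2 + m ^ 2) / 2 := by
  rw [norm_div, add_comm, mul_comm, Complex.norm_add_mul_I]
  simp [add_comm]

/-- With $s=\sqrt{\nu^2+m^2}$, the two terms of the phase have modulus $2\pi|z|\in[2\pi R/3,6\pi R]$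
and $s/2$. Outside the stated range one is at least twice the other, and $S\le R+2s$ leaves room for
the factor 10. -/
lemma le_norm_phaseDeriv {R ν : ℝ} {m : ℤ} {z : ℂ} (hR : 0 < R) (hz : z ∈ annulus R)
    (h : Real.sqrt (ν ^ 2 + (m : ℝ) ^ 2) ∉
      Icc (2 * Real.pi / 3 * R) (24 * Real.pi * R)) :
    (R + |ν| + |(m : ℝ)|) / 10 ≤ ‖phaseDeriv ν m z‖ := by
  have h1 : |ν| ≤ Real.sqrt (ν ^ 2 + (m : ℝ) ^ 2) := Real.abs_le_sqrt (by nlinarith)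
  have h2 : |(m : ℝ)| ≤ Real.sqrt (ν ^ 2 + (m : ℝ) ^ 2) := Real.abs_le_sqrt (by nlinarith)
  have ha := norm_mul_add_half ν m
  push_cast at ha
  have hb : ‖2 * Real.pi * Complex.I * z‖ = 2 * Real.pi * ‖z‖ := by
    simp [abs_of_pos Real.pi_pos]
  have hpi := Real.pi_gt_three
  have hz1 := hz.1
  have hz2 := hz.2
  rw [mem_Icc, not_and_or, not_le, not_le] at h
  have hR3 : 3 * R ≤ Real.pi * R := by nlinarith
  have hpz1 : Real.pi * (R / 3) ≤ Real.pi * ‖z‖ := by gcongr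
  have hpz2 : Real.pi * ‖z‖ ≤ Real.pi * (3 * R) := by gcongr
  have hpi4 : Real.pi * R ≤ 4 * R := by nlinarith [Real.pi_lt_four]
  rcases h with h | h
  · have := norm_sub_le_norm_add (2 * Real.pi * Complex.I * z) ((Complex.I * ν + m) / 2)
    rw [hb, ha] at this
    rw [phaseDeriv]
    linarith
  · have := norm_sub_le_norm_add ((Complex.I * ν + m) / 2) (2 * Real.pi * Complex.I * z)
    rw [hb, ha, add_comm ((Complex.I * ν + m) / 2)] at this
    rw [phaseDeriv]
    linarith

lemma continuous_phaseDeriv (ν : ℝ) (m : ℤ) : Continuous (phaseDeriv ν m) := by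
  unfold phaseDeriv
  fun_prop

lemma hasDerivAt_phaseDeriv (ν : ℝ) (m : ℤ) (z : ℂ) :
    HasDerivAt (phaseDeriv ν m) (2 * Real.pi * Complex.I) z := by
  unfold phaseDeriv
  simpa using ((hasDerivAt_id z).const_mul (2 * Real.pi * Complex.I)).add_const
    ((Complex.I * ν + m) / 2)

lemma contDiff_phaseDeriv (ν : ℝ) (m : ℤ) : ContDiff ℂ 1 (phaseDeriv ν m) := by
  unfold phaseDeriv
  fun_prop

lemma hasEulerDerivAt_pow_mul_inv_pow (ν : ℝ) (m : ℤ) (k l : ℕ) {z : ℂ}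
    (hD : phaseDeriv ν m z ≠ 0) :
    HasEulerDerivAt (fun x => x ^ k * (phaseDeriv ν m x)⁻¹ ^ (l + 1))
      (k * (z ^ k * (phaseDeriv ν m z)⁻¹ ^ (l + 1)) -
        2 * Real.pi * Complex.I * (l + 1) * (z ^ (k + 1) * (phaseDeriv ν m z)⁻¹ ^ (l + 2))) z := by
  have h1 : HasEulerDerivAt (fun x => x ^ k) (k * z ^ k) z := by
    refine ((HasEulerDerivAt.id z).comp_holomorphic (h := fun x => x ^ k)
      (by fun_prop)).congr_deriv ?_
    rw [deriv_pow_field]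
    rcases k with _ | k
    · simp
    · simp [pow_succ]
      ring
  have h2 : HasDerivAt (fun x => (phaseDeriv ν m x)⁻¹ ^ (l + 1))
      (-(2 * Real.pi * Complex.I * (l + 1)) * (phaseDeriv ν m z)⁻¹ ^ (l + 2)) z := by
    refine (((hasDerivAt_phaseDeriv ν m z).inv hD).pow (l + 1)).congr_deriv ?_
    simp
    field_simp
    ring
  have h3 : ContDiffAt ℂ 1 (fun x => (phaseDeriv ν m x)⁻¹ ^ (l + 1)) z :=
    ((contDiff_phaseDeriv ν m).contDiffAt.inv hD).pow _
  refine (h1.mul ((HasEulerDerivAt.id z).comp_holomorphic h3)).congr_deriv ?_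
  rw [h2.deriv]
  ring

lemma continuousAt_osc (ν : ℝ) (m : ℤ) {z : ℂ} (hz : z ≠ 0) : ContinuousAt (osc ν m) z :=
  (hasEulerDerivAt_osc ν m hz).contDiffAt.continuousAt

/-! ### Decay away from the stationary range -/

/-- Non-stationary phase: repeated integration by parts against the Euler operator. -/
theorem exists_norm_integral_osc_le (N : ℕ) : ∀ w : ℝ → ℂ, IsBump w → ∀ k l : ℕ,
    ∃ C, 0 ≤ C ∧ ∀ (R S ν : ℝ) (m : ℤ), 0 < R → R ≤ S →
      (∀ z ∈ annulus R, S / 10 ≤ ‖phaseDeriv ν m z‖) →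
      ‖∫ z, w (‖z‖ / R) * (z ^ k * (phaseDeriv ν m z)⁻¹ ^ l * osc ν m z) / (‖z‖ : ℂ) ^ 2‖ ≤
        C * R ^ k * S⁻¹ ^ (l + N) := by
  induction N with
  | zero =>
    intro w hw k l
    obtain ⟨M, hM0, hM⟩ := hw.exists_norm_le
    refine ⟨M * (81 * Real.pi) * 3 ^ k * 10 ^ l, by positivity, fun R S ν m hR hRS hD => ?_⟩
    have hS : 0 < S := hR.trans_le hRS
    refine (hw.norm_integral_le_of_norm_le_const hM hR (K := (3 * R) ^ k * (10 * S⁻¹) ^ l)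
      (fun z hz => ?_) (by positivity)).trans (le_of_eq ?_)
    · rw [norm_mul, norm_mul, norm_osc _ _ (ne_zero_of_mem_annulus hR hz), mul_one, norm_pow,
        norm_pow, norm_inv]
      gcongr
      · exact hz.2
      · calc ‖phaseDeriv ν m z‖⁻¹ ≤ (S / 10)⁻¹ := by
              gcongr
              exact hD z hz
          _ = _ := by rw [inv_div]; ring
    · rw [mul_pow, mul_pow]
      ring
  | succ N ih =>
    intro w hw k l
    obtain ⟨C₁, hC₁, h₁⟩ := ih _ hw.isBump_radialDeriv k (l + 1)
    obtain ⟨C₂, hC₂, h₂⟩ := ih w hw k (l + 1)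
    obtain ⟨C₃, hC₃, h₃⟩ := ih w hw (k + 1) (l + 2)
    refine ⟨1 / 2 * C₁ + k * C₂ + 2 * Real.pi * (l + 1) * C₃, by positivity,
      fun R S ν m hR hRS hD => ?_⟩
    have hS : 0 < S := hR.trans_le hRS
    have hD0 : ∀ z ∈ annulus R, phaseDeriv ν m z ≠ 0 := fun z hz h0 => by
      have := hD z hz
      rw [h0, norm_zero] at this
      linarith
    -- The family $z^kD^{-l}\,\mathrm{osc}$ is closed under the procedure: applying $E$ to `T k (l +
    -- 1)` returns `T k l` plus terms with more factors $D^{-1}$, because $D'$ is constant.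
    set T : ℕ → ℕ → ℂ → ℂ := fun k l z => z ^ k * (phaseDeriv ν m z)⁻¹ ^ l * osc ν m z with hT
    have hc (k l : ℕ) : ∀ z ∈ annulus R, ContinuousAt (T k l) z := fun z hz =>
      ((continuousAt_id.pow k).mul
        (((continuous_phaseDeriv ν m).continuousAt.inv₀ (hD0 z hz)).pow l)).mul
          (continuousAt_osc ν m (ne_zero_of_mem_annulus hR hz))
    have hE : ∀ z ∈ annulus R, HasEulerDerivAt (T k (l + 1))
        (k * T k (l + 1) z - 2 * Real.pi * Complex.I * (l + 1) * T (k + 1) (l + 2) z + T k l z)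
          z := fun z hz => by
      refine ((hasEulerDerivAt_pow_mul_inv_pow ν m k l (hD0 z hz)).mul
        (hasEulerDerivAt_osc ν m (ne_zero_of_mem_annulus hR hz))).congr_deriv ?_
      have := hD0 z hz
      simp only [hT]
      rw [pow_succ _ l]
      field_simp
    have hparts := hw.integral_mul_eulerDeriv hR hE (fun z hz =>
      (((hc k (l + 1) z hz).const_mul _).sub ((hc (k + 1) (l + 2) z hz).const_mul _)).add
        (hc k l z hz))
    have hi (k l : ℕ) := hw.integrable_div hR (hc k l)
    have hsplit (z : ℂ) : w (‖z‖ / R) * (k * T k (l + 1) z -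
        2 * Real.pi * Complex.I * (l + 1) * T (k + 1) (l + 2) z + T k l z) / (‖z‖ : ℂ) ^ 2 =
        k * (w (‖z‖ / R) * T k (l + 1) z / (‖z‖ : ℂ) ^ 2) -
          2 * Real.pi * Complex.I * (l + 1) * (w (‖z‖ / R) * T (k + 1) (l + 2) z / (‖z‖ : ℂ) ^ 2) +
          w (‖z‖ / R) * T k l z / (‖z‖ : ℂ) ^ 2 := by ring
    simp_rw [hsplit] at hparts
    have hsub : Integrable fun z => k * (w (‖z‖ / R) * T k (l + 1) z / (‖z‖ : ℂ) ^ 2) -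
        2 * Real.pi * Complex.I * (l + 1) * (w (‖z‖ / R) * T (k + 1) (l + 2) z / (‖z‖ : ℂ) ^ 2) :=
      ((hi _ _).const_mul _).sub ((hi _ _).const_mul _)
    rw [integral_add hsub (hi _ _),
      integral_sub ((hi _ _).const_mul _) ((hi _ _).const_mul _), integral_const_mul,
      integral_const_mul] at hparts
    have b₁ := h₁ R S ν m hR hRS hD
    have b₂ := h₂ R S ν m hR hRS hD
    have b₃ := h₃ R S ν m hR hRS hD
    have hRS' : R * S⁻¹ ≤ 1 := by
      rw [mul_inv_le_iff₀ hS]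
      linarith
    have hid := eq_sub_of_add_eq' hparts
    calc _ = ‖∫ z, w (‖z‖ / R) * T k l z / (‖z‖ : ℂ) ^ 2‖ := rfl
      _ ≤ 1 / 2 * ‖∫ z, radialDeriv w (‖z‖ / R) * T k (l + 1) z / (‖z‖ : ℂ) ^ 2‖ +
          (k * ‖∫ z, w (‖z‖ / R) * T k (l + 1) z / (‖z‖ : ℂ) ^ 2‖ +
          2 * Real.pi * (l + 1) * ‖∫ z, w (‖z‖ / R) * T (k + 1) (l + 2) z / (‖z‖ : ℂ) ^ 2‖) := by
        rw [hid]
        refine (norm_sub_le _ _).trans (add_le_add ?_ ((norm_sub_le _ _).trans ?_))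
        · rw [norm_mul]
          norm_num
        · have : ‖(l : ℂ) + 1‖ = l + 1 := by exact_mod_cast Complex.norm_natCast (l + 1)
          simp [this, abs_of_pos Real.pi_pos]
      _ ≤ 1 / 2 * (C₁ * R ^ k * S⁻¹ ^ (l + 1 + N)) + (k * (C₂ * R ^ k * S⁻¹ ^ (l + 1 + N)) +
          2 * Real.pi * (l + 1) * (C₃ * R ^ (k + 1) * S⁻¹ ^ (l + 2 + N))) := by
        gcongr
      _ ≤ 1 / 2 * (C₁ * R ^ k * S⁻¹ ^ (l + 1 + N)) + (k * (C₂ * R ^ k * S⁻¹ ^ (l + 1 + N)) +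
          2 * Real.pi * (l + 1) * (C₃ * R ^ k * S⁻¹ ^ (l + 1 + N))) := by
        -- Differentiating $D^{-1}$ costs a factor $R$ but gains $S^{-2}$; with $R\le S$ the net
        -- gain is still $S^{-1}$.
        have : C₃ * R ^ (k + 1) * S⁻¹ ^ (l + 2 + N) ≤ C₃ * R ^ k * S⁻¹ ^ (l + 1 + N) := by
          rw [show C₃ * R ^ (k + 1) * S⁻¹ ^ (l + 2 + N) =
            C₃ * R ^ k * S⁻¹ ^ (l + 1 + N) * (R * S⁻¹) by ring]
          exact mul_le_of_le_one_right (by positivity) hRS'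
        gcongr
      _ = _ := by
        rw [show l + (N + 1) = l + 1 + N by ring]
        ring

theorem exists_norm_xi_le_rpow {v : ℝ → ℝ} (hv : IsCutoff v) {R₀ : ℝ} (hR₀ : 1 < R₀) (A : ℝ) :
    ∃ C : ℝ, ∀ R : ℝ, R₀ ≤ R → ∀ (ν : ℝ) (m : ℤ),
      Real.sqrt (ν ^ 2 + (m : ℝ) ^ 2) ∉ Icc (2 * Real.pi / 3 * R) (24 * Real.pi * R) →
        ‖xi v R ν m‖ ≤ C * (R + |ν| + |(m : ℝ)|) ^ (-A) := by
  obtain ⟨N, hN⟩ := exists_nat_ge A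
  obtain ⟨C, hC, h⟩ := exists_norm_integral_osc_le N _ hv.isBump 0 0
  refine ⟨1 / (2 * Real.pi ^ 2) * C, fun R hR ν m hm => ?_⟩
  have hR0 : 0 < R := by linarith
  have hS : R ≤ R + |ν| + |(m : ℝ)| := by
    have := abs_nonneg ν
    have := abs_nonneg (m : ℝ)
    linarith
  have h1 := h R _ ν m hR0 hS fun z hz => le_norm_phaseDeriv hR0 hz hm
  simp only [pow_zero, one_mul, mul_one, zero_add] at h1
  have h2 : ‖(1 / (2 * Real.pi ^ 2) : ℂ)‖ = 1 / (2 * Real.pi ^ 2) := by simp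
  rw [xi_eq v hR0, norm_mul, h2, mul_assoc]
  gcongr
  refine h1.trans ?_
  gcongr
  rw [← Real.rpow_natCast, Real.inv_rpow (by linarith), ← Real.rpow_neg (by linarith)]
  exact Real.rpow_le_rpow_of_exponent_le (by linarith) (by linarith)

/-! ### The stationary range -/

lemma integral_closedBall_inv_sq_add {R ρ : ℝ} (hR : 0 < R) (hρ : 0 ≤ ρ) :
    ∫ z : ℂ, (Metric.closedBall (0 : ℂ) ρ).indicator (fun z => (‖z‖ ^ 2 + R)⁻¹) z =
      Real.pi * Real.log ((ρ ^ 2 + R) / R) := by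
  have h1 : (Metric.closedBall (0 : ℂ) ρ).indicator (fun z => (‖z‖ ^ 2 + R)⁻¹) =
      fun z => (Iic ρ).indicator (fun y => (y ^ 2 + R)⁻¹) ‖z‖ := by
    ext z
    by_cases hz : ‖z‖ ≤ ρ <;> simp [indicator, hz]
  have hpos (y : ℝ) : y ^ 2 + R ≠ 0 := by positivity
  have h2 : ∫ y in Ioi (0 : ℝ), y ^ 1 • (Iic ρ).indicator (fun y => (y ^ 2 + R)⁻¹) y =
      1 / 2 * Real.log ((ρ ^ 2 + R) / R) := by
    have h3 : (fun y : ℝ => y ^ 1 • (Iic ρ).indicator (fun y => (y ^ 2 + R)⁻¹) y) =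
        (Iic ρ).indicator fun y => y * (y ^ 2 + R)⁻¹ := by
      ext y
      by_cases hy : y ≤ ρ <;> simp [hy]
    rw [h3, setIntegral_indicator measurableSet_Iic, Ioi_inter_Iic,
      ← intervalIntegral.integral_of_le hρ,
      intervalIntegral.integral_eq_sub_of_hasDerivAt (f := fun y => 1 / 2 * Real.log (y ^ 2 + R))]
    · rw [Real.log_div (hpos ρ) hR.ne']
      simp
      ring
    · intro y _
      refine ((((hasDerivAt_pow 2 y).add_const R).log (hpos y)).const_mul (1 / 2)).congr_deriv ?_
      simp
      field_simp
    · apply Continuous.intervalIntegrable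
      exact continuous_id.mul ((by fun_prop : Continuous fun y : ℝ => y ^ 2 + R).inv₀ hpos)
  rw [h1, integral_fun_norm_addHaar volume]
  simp only [Complex.finrank_real_complex]
  rw [h2, measureReal_def, Complex.volume_ball]
  simp
  ring

lemma phaseDeriv_eq_mul_sub (ν : ℝ) (m : ℤ) (z : ℂ) : phaseDeriv ν m z =
    2 * Real.pi * Complex.I * (z - -((Complex.I * ν + m) / 2) / (2 * Real.pi * Complex.I)) := by
  rw [phaseDeriv]
  have : (Real.pi : ℂ) ≠ 0 := by exact_mod_cast Real.pi_ne_zero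
  field_simp
  ring

lemma norm_two_pi_I : ‖(2 * Real.pi * Complex.I : ℂ)‖ = 2 * Real.pi := by
  simp [abs_of_pos Real.pi_pos]

/-- The planar integral responsible for the logarithm in the stationary range. -/
lemma setIntegral_annulus_inv_le {R ν : ℝ} {m : ℤ} (hR : 0 < R)
    (h : Real.sqrt (ν ^ 2 + (m : ℝ) ^ 2) ≤ 24 * Real.pi * R) :
    ∫ z in annulus R, (‖phaseDeriv ν m z‖ ^ 2 + R)⁻¹ ≤ Real.pi * Real.log (81 * R + 1) := by
  have hpi := Real.pi_gt_three
  set z₀ : ℂ := -((Complex.I * ν + m) / 2) / (2 * Real.pi * Complex.I) with hz₀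
  -- The zero of the phase is at distance at most $6R$ from 0, so the annulus lies in the disc of
  -- radius $9R$ about it.
  have hn : ‖z₀‖ ≤ 6 * R := by
    have ha := norm_mul_add_half ν m
    push_cast at ha
    rw [hz₀, norm_div, norm_neg, ha, norm_two_pi_I, div_le_iff₀ (by positivity)]
    linarith
  set g : ℂ → ℝ := (Metric.closedBall (0 : ℂ) (9 * R)).indicator (fun z => (‖z‖ ^ 2 + R)⁻¹)
    with hg
  have hgi : Integrable g := by
    rw [hg, integrable_indicator_iff measurableSet_closedBall]
    refine ContinuousOn.integrableOn_compact (isCompact_closedBall _ _) (Continuous.continuousOn ?_)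
    exact (by fun_prop : Continuous fun z : ℂ => ‖z‖ ^ 2 + R).inv₀ fun z => by positivity
  have hg0 (z : ℂ) : 0 ≤ g z := indicator_nonneg (fun z _ => by positivity) z
  have hle (z : ℂ) (hz : z ∈ annulus R) : (‖phaseDeriv ν m z‖ ^ 2 + R)⁻¹ ≤ g (z - z₀) := by
    have hmem : z - z₀ ∈ Metric.closedBall (0 : ℂ) (9 * R) := by
      rw [mem_closedBall_zero_iff]
      have := norm_sub_le z z₀
      have := hz.2
      linarith
    rw [hg, indicator_of_mem hmem, phaseDeriv_eq_mul_sub, norm_mul, norm_two_pi_I]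
    gcongr
    exact le_mul_of_one_le_left (norm_nonneg _) (by linarith)
  calc ∫ z in annulus R, (‖phaseDeriv ν m z‖ ^ 2 + R)⁻¹
      ≤ ∫ z in annulus R, g (z - z₀) := by
        refine integral_mono_of_nonneg (.of_forall fun z => by positivity)
          (hgi.comp_sub_right z₀).integrableOn ?_
        exact (ae_restrict_iff' (isClosed_annulus R).measurableSet).2 (.of_forall hle)
    _ ≤ ∫ z, g (z - z₀) :=
        setIntegral_le_integral (hgi.comp_sub_right z₀) (.of_forall fun z => hg0 _)
    _ = ∫ z, g z := integral_sub_right_eq_self g z₀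
    _ = Real.pi * Real.log (81 * R + 1) := by
        rw [hg, integral_closedBall_inv_sq_add hR (by positivity)]
        congr 2
        field_simp
        ring

/-- A substitute for $1/D$ that is smooth through the zero of $D$. The regularizing constant $R$
matches the stationary scale $|z-z_0|\sim\sqrt R$. -/
lemma hasEulerDerivAt_regularized {R ν : ℝ} {m : ℤ} (hR : 0 < R) (z : ℂ) :
    HasEulerDerivAt (fun x => (starRingEnd ℂ) (phaseDeriv ν m x) *
        (phaseDeriv ν m x * (starRingEnd ℂ) (phaseDeriv ν m x) + R)⁻¹)
      (-((starRingEnd ℂ) (phaseDeriv ν m z) ^ 2 * (2 * Real.pi * Complex.I * z) *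
        (phaseDeriv ν m z * (starRingEnd ℂ) (phaseDeriv ν m z) + R)⁻¹ ^ 2)) z := by
  have hQ : phaseDeriv ν m z * (starRingEnd ℂ) (phaseDeriv ν m z) + R ≠ 0 := by
    rw [Complex.mul_conj']
    have : (0 : ℝ) < ‖phaseDeriv ν m z‖ ^ 2 + R := by positivity
    exact_mod_cast this.ne'
  have h1 : HasEulerDerivAt (fun x => (starRingEnd ℂ) (phaseDeriv ν m x)) 0 z := by
    have : (fun x => (starRingEnd ℂ) (phaseDeriv ν m x)) = fun x =>
        (fun y : ℂ => -(2 * Real.pi * Complex.I) * y +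
          (starRingEnd ℂ) ((Complex.I * ν + m) / 2)) ((starRingEnd ℂ) x) := by
      ext x
      simp [phaseDeriv, map_ofNat (starRingEnd ℂ) 2]
    have hh : ContDiffAt ℂ 1 (fun y : ℂ => -(2 * Real.pi * Complex.I) * y +
        (starRingEnd ℂ) ((Complex.I * ν + m) / 2)) ((starRingEnd ℂ) z) := by fun_prop
    rw [this]
    exact ((HasEulerDerivAt.conj z).comp_holomorphic hh).congr_deriv (mul_zero _)
  have h2 : HasEulerDerivAt (phaseDeriv ν m) (2 * Real.pi * Complex.I * z) z :=
    ((HasEulerDerivAt.id z).comp_holomorphic (contDiff_phaseDeriv ν m).contDiffAt).congr_deriv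
      (by rw [(hasDerivAt_phaseDeriv ν m z).deriv])
  have h3 : ContDiffAt ℂ 1 (fun y : ℂ => (y + R)⁻¹)
      (phaseDeriv ν m z * (starRingEnd ℂ) (phaseDeriv ν m z)) :=
    (contDiffAt_id.add contDiffAt_const).inv hQ
  have h4 : deriv (fun y : ℂ => (y + R)⁻¹)
      (phaseDeriv ν m z * (starRingEnd ℂ) (phaseDeriv ν m z)) = _ :=
    (((hasDerivAt_id (phaseDeriv ν m z * (starRingEnd ℂ) (phaseDeriv ν m z))).add_const
      (R : ℂ)).inv hQ).deriv
  refine (h1.mul ((h2.mul h1).comp_holomorphic h3)).congr_deriv ?_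
  rw [h4]
  simp only [id]
  field_simp
  ring

/-- Writing $Q=|D|^2+R$, one has $\bar D D/Q=1-R/Q$, so integrating $E(\bar D Q^{-1}\mathrm{osc})$
by parts isolates the wanted integral. The defect $R/Q$, the derivative of $\bar D/Q$, and the
cutoff term are each $O(R/Q)$ on the annulus. -/
lemma IsBump.norm_integral_osc_le {w : ℝ → ℂ} (hw : IsBump w) {M M' R ν : ℝ} {m : ℤ}
    (hM : ∀ x, ‖w x‖ ≤ M) (hM' : ∀ x, ‖radialDeriv w x‖ ≤ M') (hR : 0 < R)
    (h : Real.sqrt (ν ^ 2 + (m : ℝ) ^ 2) ≤ 24 * Real.pi * R) :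
    ‖∫ z, w (‖z‖ / R) * osc ν m z / (‖z‖ : ℂ) ^ 2‖ ≤
      (M * (1 + 6 * Real.pi) + M' * (9 * Real.pi)) * (9 * Real.pi) *
        (Real.log (81 * R + 1) / R) := by
  have hM0 := (norm_nonneg _).trans (hM 0)
  have hM0' := (norm_nonneg _).trans (hM' 0)
  set D := phaseDeriv ν m with hD
  set Q : ℂ → ℂ := fun z => D z * (starRingEnd ℂ) (D z) + R with hQdef
  have hQ (z : ℂ) : Q z = ((‖D z‖ ^ 2 + R : ℝ) : ℂ) := by
    simp only [hQdef, Complex.mul_conj']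
    push_cast
    ring
  have hq (z : ℂ) : 0 < ‖D z‖ ^ 2 + R := by positivity
  have hQ0 (z : ℂ) : Q z ≠ 0 := by
    rw [hQ]
    exact_mod_cast (hq z).ne'
  have hQn (z : ℂ) : ‖(Q z)⁻¹‖ = (‖D z‖ ^ 2 + R)⁻¹ := by
    rw [norm_inv, hQ, Complex.norm_real, Real.norm_of_nonneg (hq z).le]
  have hDc : Continuous D := continuous_phaseDeriv ν m
  have hQc : Continuous fun z => (Q z)⁻¹ :=
    ((hDc.mul (Complex.continuous_conj.comp hDc)).add continuous_const).inv₀ hQ0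
  have hDb (z : ℂ) (hz : z ∈ annulus R) : ‖D z‖ ≤ 18 * Real.pi * R := by
    have ha := norm_mul_add_half ν m
    push_cast at ha
    have h1 := norm_add_le (2 * Real.pi * Complex.I * z) ((Complex.I * ν + m) / 2)
    rw [ha, norm_mul, norm_two_pi_I] at h1
    have : Real.pi * ‖z‖ ≤ Real.pi * (3 * R) := mul_le_mul_of_nonneg_left hz.2 Real.pi_pos.le
    rw [hD, phaseDeriv]
    linarith
  set P : ℂ → ℂ := fun z => (starRingEnd ℂ) (D z) ^ 2 * (2 * Real.pi * Complex.I * z) * (Q z)⁻¹ ^ 2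
    with hP
  have hPc : Continuous P :=
    ((((Complex.continuous_conj.comp hDc).pow 2).mul (by fun_prop)).mul (hQc.pow 2))
  have hosc : ∀ z ∈ annulus R, ContinuousAt (osc ν m) z := fun z hz =>
    continuousAt_osc ν m (ne_zero_of_mem_annulus hR hz)
  have hE : ∀ z ∈ annulus R, HasEulerDerivAt (fun x => (starRingEnd ℂ) (D x) * (Q x)⁻¹ * osc ν m x)
      (osc ν m z - (R * (Q z)⁻¹ + P z) * osc ν m z) z := fun z hz => by
    refine ((hasEulerDerivAt_regularized hR z).mul
      (hasEulerDerivAt_osc ν m (ne_zero_of_mem_annulus hR hz))).congr_deriv ?_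
    have h1 : D z * (starRingEnd ℂ) (D z) * (Q z)⁻¹ = 1 - R * (Q z)⁻¹ := by
      rw [show D z * (starRingEnd ℂ) (D z) = Q z - R by simp [hQdef], sub_mul,
        mul_inv_cancel₀ (hQ0 z)]
    simp only [hP]
    linear_combination osc ν m z * h1
  have hc : ∀ z ∈ annulus R, ContinuousAt (fun z => (R * (Q z)⁻¹ + P z) * osc ν m z) z :=
    fun z hz => (((hQc.const_mul _).add hPc).continuousAt).mul (hosc z hz)
  have hparts := hw.integral_mul_eulerDeriv hR hE fun z hz => (hosc z hz).sub (hc z hz)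
  simp_rw [mul_sub, sub_div] at hparts
  rw [integral_sub (hw.integrable_div hR hosc) (hw.integrable_div hR hc)] at hparts
  have hBi : IntegrableOn (fun z => (‖D z‖ ^ 2 + R)⁻¹) (annulus R) := by
    refine ContinuousOn.integrableOn_compact (isCompact_annulus R) (Continuous.continuousOn ?_)
    exact ((hDc.norm.pow 2).add continuous_const).inv₀ fun z => (hq z).ne'
  have b1 := hw.norm_integral_le hM hR (F := fun z => (R * (Q z)⁻¹ + P z) * osc ν m z)
    (B := fun z => (1 + 6 * Real.pi) * R * (‖D z‖ ^ 2 + R)⁻¹) (fun z hz => by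
      rw [norm_mul, norm_osc _ _ (ne_zero_of_mem_annulus hR hz), mul_one]
      refine (norm_add_le _ _).trans ?_
      have e1 : ‖R * (Q z)⁻¹‖ = R * (‖D z‖ ^ 2 + R)⁻¹ := by
        rw [norm_mul, hQn, Complex.norm_real, Real.norm_of_nonneg hR.le]
      have e2 : ‖P z‖ = (‖D z‖ ^ 2 * (‖D z‖ ^ 2 + R)⁻¹) * (2 * Real.pi * ‖z‖) *
          (‖D z‖ ^ 2 + R)⁻¹ := by
        simp only [hP]
        rw [norm_mul, norm_mul, norm_mul, norm_two_pi_I, norm_pow, norm_pow, hQn, RCLike.norm_conj]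
        ring
      -- One factor $|D|^2/Q\le1$ is absorbed, leaving a single $Q^{-1}$, whose integral is only
      -- logarithmic.
      have e3 : ‖D z‖ ^ 2 * (‖D z‖ ^ 2 + R)⁻¹ ≤ 1 := by
        rw [mul_inv_le_iff₀ (hq z)]
        linarith
      have e4 : ‖P z‖ ≤ 1 * (2 * Real.pi * (3 * R)) * (‖D z‖ ^ 2 + R)⁻¹ := by
        rw [e2]
        have := hq z
        gcongr
        exact hz.2
      rw [e1]
      linarith) (hBi.const_mul _)
  have b2 := hw.isBump_radialDeriv.norm_integral_le hM' hR
    (F := fun z => (starRingEnd ℂ) (D z) * (Q z)⁻¹ * osc ν m z)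
    (B := fun z => 18 * Real.pi * R * (‖D z‖ ^ 2 + R)⁻¹) (fun z hz => by
      rw [norm_mul, norm_osc _ _ (ne_zero_of_mem_annulus hR hz), mul_one, norm_mul, hQn,
        RCLike.norm_conj]
      have := hq z
      gcongr
      exact hDb z hz) (hBi.const_mul _)
  rw [integral_const_mul] at b1 b2
  have hlog := setIntegral_annulus_inv_le hR h
  rw [eq_add_of_sub_eq hparts]
  calc _ ≤ 1 / 2 * (M' * (9 / R ^ 2) *
        (18 * Real.pi * R * ∫ z in annulus R, (‖D z‖ ^ 2 + R)⁻¹)) +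
      M * (9 / R ^ 2) * ((1 + 6 * Real.pi) * R * ∫ z in annulus R, (‖D z‖ ^ 2 + R)⁻¹) := by
        refine (norm_add_le _ _).trans (add_le_add ?_ b1)
        rw [norm_mul]
        gcongr
        norm_num
    _ ≤ 1 / 2 * (M' * (9 / R ^ 2) * (18 * Real.pi * R * (Real.pi * Real.log (81 * R + 1)))) +
      M * (9 / R ^ 2) * ((1 + 6 * Real.pi) * R * (Real.pi * Real.log (81 * R + 1))) := by
        gcongr
    _ = _ := by
        field_simp
        ring

theorem exists_norm_xi_le_log_div {v : ℝ → ℝ} (hv : IsCutoff v) {R₀ : ℝ} (hR₀ : 1 < R₀) :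
    ∃ C : ℝ, ∀ R : ℝ, R₀ ≤ R → ∀ (ν : ℝ) (m : ℤ),
      Real.sqrt (ν ^ 2 + (m : ℝ) ^ 2) ≤ 24 * Real.pi * R →
        ‖xi v R ν m‖ ≤ C * (Real.log R / R) := by
  obtain ⟨M, hM0, hM⟩ := hv.isBump.exists_norm_le
  obtain ⟨M', hM0', hM'⟩ := hv.isBump.isBump_radialDeriv.exists_norm_le
  have hl0 : 0 < Real.log R₀ := Real.log_pos hR₀
  refine ⟨1 / (2 * Real.pi ^ 2) * ((M * (1 + 6 * Real.pi) + M' * (9 * Real.pi)) *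
    (9 * Real.pi)) * (Real.log 82 / Real.log R₀ + 1), fun R hR ν m h => ?_⟩
  have hR0 : 0 < R := by linarith
  have h2 : ‖(1 / (2 * Real.pi ^ 2) : ℂ)‖ = 1 / (2 * Real.pi ^ 2) := by simp
  -- Here $R_0>1$ matters: $\log R$ is bounded below by $\log R_0>0$, so the additive $\log 82$ is
  -- absorbed into a multiple of $\log R$.
  have hlog : Real.log (81 * R + 1) ≤ (Real.log 82 / Real.log R₀ + 1) * Real.log R := by
    have h3 : Real.log R₀ ≤ Real.log R := Real.log_le_log (by linarith) hR
    have h4 : Real.log 82 ≤ Real.log 82 / Real.log R₀ * Real.log R := by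
      rw [div_mul_eq_mul_div, le_div_iff₀ hl0]
      exact mul_le_mul_of_nonneg_left h3 (Real.log_nonneg (by norm_num))
    calc Real.log (81 * R + 1) ≤ Real.log (82 * R) := Real.log_le_log (by positivity) (by linarith)
      _ = Real.log 82 + Real.log R := Real.log_mul (by norm_num) hR0.ne'
      _ ≤ _ := by linarith
  rw [xi_eq v hR0, norm_mul, h2]
  calc _ ≤ 1 / (2 * Real.pi ^ 2) * ((M * (1 + 6 * Real.pi) + M' * (9 * Real.pi)) *
        (9 * Real.pi) * (Real.log (81 * R + 1) / R)) := by
        gcongr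
        exact hv.isBump.norm_integral_osc_le hM hM' hR0 h
    _ ≤ 1 / (2 * Real.pi ^ 2) * ((M * (1 + 6 * Real.pi) + M' * (9 * Real.pi)) *
        (9 * Real.pi) * ((Real.log 82 / Real.log R₀ + 1) * Real.log R / R)) := by
        gcongr
    _ = _ := by ring

/-! ### Absolute convergence on the dual group -/

lemma continuous_e : Continuous e := by
  unfold e
  fun_prop

lemma continuous_char (m : ℤ) {z : ℂ} (hz : z ≠ 0) : Continuous fun ν => char ν m z := by
  have h : (‖z‖ : ℂ) ≠ 0 := by simpa using hz
  have : Continuous fun ν : ℝ => (‖z‖ : ℂ) ^ (2 * Complex.I * (ν : ℂ)) :=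
    (by fun_prop : Continuous fun ν : ℝ => 2 * Complex.I * (ν : ℂ)).const_cpow (Or.inl h)
  exact this.mul continuous_const

lemma continuous_xi {v : ℝ → ℝ} (hv : IsCutoff v) {R : ℝ} (hR : 0 < R) (m : ℤ) :
    Continuous fun ν => xi v R ν m := by
  simp_rw [xi_eq v hR]
  refine continuous_const.mul ?_
  have hb := hv.isBump
  refine continuous_of_dominated
    (bound := fun z => ‖extendZero v (‖z‖ / R) * 1 / (‖z‖ : ℂ) ^ 2‖) (fun ν => ?_) (fun ν => ?_) ?_ ?_
  · exact (hb.integrable_div hR fun z hz =>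
      continuousAt_osc ν m (ne_zero_of_mem_annulus hR hz)).aestronglyMeasurable
  · refine .of_forall fun z => ?_
    by_cases hz : z = 0
    · simp [hz]
    · simp [norm_osc ν m hz]
  · exact (hb.integrable_div hR (F := fun _ => 1) fun z _ => continuousAt_const).norm
  · refine .of_forall fun z => ?_
    by_cases hz : z = 0
    · simp [hz]
      exact continuous_const
    · have : Continuous fun ν : ℝ => osc ν m z :=
        continuous_const.mul ((continuous_char m hz).comp (continuous_id.div_const 2))
      exact (continuous_const.mul this).div_const _

/-- For fixed $R$, the decay estimate with $A=4$ suffices outside the disc of radius $24\pi R$,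
since $(1+\nu^2)(1+m^2)\le S^4$. Inside, a constant bound is enough. -/
lemma exists_norm_xi_le {v : ℝ → ℝ} (hv : IsCutoff v) {R : ℝ} (hR : 1 < R) :
    ∃ K : ℝ, ∀ (ν : ℝ) (m : ℤ), ‖xi v R ν m‖ ≤ K * ((1 + ν ^ 2)⁻¹ * (1 + (m : ℝ) ^ 2)⁻¹) := by
  obtain ⟨C, hC⟩ := exists_norm_xi_le_rpow hv hR 4
  obtain ⟨C', hC'⟩ := exists_norm_xi_le_log_div hv hR
  set T := (24 * Real.pi * R) ^ 2 with hT
  have hR0 : 0 < R := by linarith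
  refine ⟨max C 0 + |C' * (Real.log R / R)| * (1 + T) ^ 2, fun ν m => ?_⟩
  have hν : 0 < 1 + ν ^ 2 := by positivity
  have hm : 0 < 1 + (m : ℝ) ^ 2 := by positivity
  have key : ‖xi v R ν m‖ * ((1 + ν ^ 2) * (1 + (m : ℝ) ^ 2)) ≤
      max C 0 + |C' * (Real.log R / R)| * (1 + T) ^ 2 := by
    by_cases h : Real.sqrt (ν ^ 2 + (m : ℝ) ^ 2) ≤ 24 * Real.pi * R
    · have h1 : ν ^ 2 + (m : ℝ) ^ 2 ≤ T := (Real.sqrt_le_left (by positivity)).1 h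
      have h2 : ‖xi v R ν m‖ ≤ |C' * (Real.log R / R)| :=
        (hC' R le_rfl ν m h).trans (le_abs_self _)
      have h3 : (1 + ν ^ 2) * (1 + (m : ℝ) ^ 2) ≤ (1 + T) ^ 2 := by
        rw [sq (1 + T)]
        gcongr
        · nlinarith
        · nlinarith
      refine (mul_le_mul h2 h3 (by positivity) (abs_nonneg _)).trans ?_
      linarith [le_max_right C 0]
    · set S := R + |ν| + |(m : ℝ)| with hS
      have hS1 : 1 + |ν| + |(m : ℝ)| ≤ S := by linarith
      have hS0 : 0 < S := by positivity
      have h1 := hC R le_rfl ν m fun h' => h h'.2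
      have h3 : (1 + ν ^ 2) * (1 + (m : ℝ) ^ 2) ≤ S ^ 4 := by
        rw [show S ^ 4 = S ^ 2 * S ^ 2 by ring]
        have := abs_nonneg ν
        have := abs_nonneg (m : ℝ)
        gcongr
        · rw [← sq_abs ν]
          nlinarith
        · rw [← sq_abs (m : ℝ)]
          nlinarith
      have h4 : S ^ (-4 : ℝ) * S ^ 4 = 1 := by
        rw [Real.rpow_neg hS0.le]
        norm_cast
        exact inv_mul_cancel₀ (by positivity)
      calc ‖xi v R ν m‖ * ((1 + ν ^ 2) * (1 + (m : ℝ) ^ 2))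
          ≤ (max C 0 * S ^ (-4 : ℝ)) * S ^ 4 := by
            gcongr
            exact h1.trans (by gcongr; exact le_max_left _ _)
        _ = max C 0 := by rw [mul_assoc, h4, mul_one]
        _ ≤ _ := by
          have : 0 ≤ |C' * (Real.log R / R)| * (1 + T) ^ 2 := by positivity
          linarith
  rw [← mul_inv, ← div_eq_mul_inv, le_div_iff₀ (by positivity)]
  exact key

lemma summable_inv_one_add_int_sq : Summable fun m : ℤ => (1 + (m : ℝ) ^ 2)⁻¹ := by
  -- The shift by $1/2$ avoids a vanishing denominator at $m=0$.
  have h := ((Real.summable_one_div_int_add_rpow (1 / 2) 2).2 (by norm_num)).mul_left 2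
  refine Summable.of_nonneg_of_le (fun m => by positivity) (fun m => ?_) h
  have hm : (m : ℝ) + 1 / 2 ≠ 0 := by
    intro h0
    have h1 : (2 * m + 1 : ℝ) = 0 := by linarith
    have h2 : 2 * m + 1 = 0 := by exact_mod_cast h1
    omega
  rw [Real.rpow_two, sq_abs, mul_one_div, inv_eq_one_div,
    div_le_div_iff₀ (by positivity) (by positivity)]
  nlinarith [sq_nonneg ((m : ℝ) - 1 / 2)]

lemma integrable_xi_mul_conj_char {v : ℝ → ℝ} (hv : IsCutoff v) {R : ℝ} (hR : 1 < R) {z : ℂ}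
    (hz : z ≠ 0) : Integrable (fun p : ℝ × ℤ => xi v R (2 * p.1) p.2 *
      (starRingEnd ℂ) (char p.1 p.2 z)) dualMeasure := by
  obtain ⟨K, hK⟩ := exists_norm_xi_le hv hR
  have hR0 : 0 < R := by linarith
  have h1 : Integrable (fun m : ℤ => (1 + (m : ℝ) ^ 2)⁻¹) Measure.count := by
    rw [integrable_count_iff]
    exact summable_inv_one_add_int_sq.norm
  refine ((integrable_inv_one_add_sq.mul_prod h1).const_mul |K|).mono' ?_ (.of_forall fun p => ?_)
  · refine (measurable_from_prod_countable_left fun m => Continuous.measurable ?_).aestronglyMeasurable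
    exact ((continuous_xi hv hR0 m).comp (continuous_const.mul continuous_id)).mul
      (Complex.continuous_conj.comp (continuous_char m hz))
  · rw [norm_mul, RCLike.norm_conj, norm_char _ _ hz, mul_one]
    refine (hK _ _).trans ?_
    calc K * ((1 + (2 * p.1) ^ 2)⁻¹ * (1 + (p.2 : ℝ) ^ 2)⁻¹)
        ≤ |K| * ((1 + (2 * p.1) ^ 2)⁻¹ * (1 + (p.2 : ℝ) ^ 2)⁻¹) := by
          gcongr
          exact le_abs_self K
      _ ≤ |K| * ((1 + p.1 ^ 2)⁻¹ * (1 + (p.2 : ℝ) ^ 2)⁻¹) := by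
          have : 1 + p.1 ^ 2 ≤ 1 + (2 * p.1) ^ 2 := by nlinarith [sq_nonneg p.1]
          gcongr |K| * (?_⁻¹ * _)

/-! ### Inversion: Mellin in the radius, Fourier in the angle -/

/-- The angular Fourier integral of `z ↦ e(2 Re z)` on the circle of radius `r`. -/
noncomputable def angularIntegral (m : ℤ) (r : ℝ) : ℂ :=
  ∫ θ in (-Real.pi)..Real.pi, e (2 * (r * Real.cos θ)) * Complex.exp (m * θ * Complex.I)

/-- The radial function of which `ν ↦ ξ_R(ν, m)` is the Mellin transform up to a constant. -/
noncomputable def radialPart (v : ℝ → ℝ) (R : ℝ) (m : ℤ) (r : ℝ) : ℂ :=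
  extendZero v (r / R) * angularIntegral m r

lemma continuous_angularIntegral (m : ℤ) : Continuous (angularIntegral m) := by
  refine intervalIntegral.continuous_parametric_intervalIntegral_of_continuous' ?_ _ _
  refine (continuous_e.comp (by fun_prop)).mul (by fun_prop)

lemma IsCutoff.continuous_radialPart {v : ℝ → ℝ} (hv : IsCutoff v) (R : ℝ) (m : ℤ) :
    Continuous (radialPart v R m) :=
  (hv.isBump.smooth.continuous.comp (continuous_id.div_const R)).mul (continuous_angularIntegral m)

lemma IsBump.apply_div_eq_zero {w : ℝ → ℂ} (hw : IsBump w) {R r : ℝ} (hR : 0 < R)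
    (hr : r ∉ Icc (R / 3) (3 * R)) : w (r / R) = 0 := by
  refine hw.eq_zero _ fun h => hr ⟨?_, ?_⟩
  · have := (le_div_iff₀ hR).1 h.1
    linarith
  · exact (div_le_iff₀ hR).1 h.2

lemma osc_polar (ν : ℝ) (m : ℤ) {r : ℝ} (hr : 0 < r) (θ : ℝ) :
    osc ν m (r * Complex.exp (θ * Complex.I)) =
      e (2 * (r * Real.cos θ)) * (r : ℂ) ^ (Complex.I * ν) * Complex.exp (m * θ * Complex.I) := by
  have hr0 : (r : ℂ) ≠ 0 := by exact_mod_cast hr.ne'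
  have hn : ‖(r * Complex.exp (θ * Complex.I) : ℂ)‖ = r := by
    rw [norm_mul, Complex.norm_exp_ofReal_mul_I, Complex.norm_real, Real.norm_of_nonneg hr.le,
      mul_one]
  have hre : (r * Complex.exp (θ * Complex.I) : ℂ).re = r * Real.cos θ := by
    rw [Complex.re_ofReal_mul, Complex.exp_ofReal_mul_I_re]
  rw [osc, char, hn, hre, mul_div_cancel_left₀ _ hr0, ← Complex.exp_int_mul]
  push_cast
  rw [show 2 * Complex.I * (ν / 2 : ℂ) = Complex.I * ν by ring, mul_assoc (m : ℂ)]
  ring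

lemma ofReal_mem_slitPlane_of_mem_Icc {R r : ℝ} (hR : 0 < R) (hr : r ∈ Icc (R / 3) (3 * R)) :
    (r : ℂ) ∈ Complex.slitPlane := by
  have := hr.1
  rw [Complex.ofReal_mem_slitPlane]
  linarith

lemma IsCutoff.mellinConvergent_radialPart {v : ℝ → ℝ} (hv : IsCutoff v) {R : ℝ} (hR : 0 < R)
    (m : ℤ) (s : ℂ) : MellinConvergent (radialPart v R m) s := by
  have hc : ContinuousOn (fun t : ℝ => (t : ℂ) ^ (s - 1) • radialPart v R m t)
      (Icc (R / 3) (3 * R)) := fun r hr =>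
    ((Complex.continuous_ofReal.continuousAt.cpow continuousAt_const
      (ofReal_mem_slitPlane_of_mem_Icc hR hr)).mul
        (hv.continuous_radialPart R m).continuousAt).continuousWithinAt
  refine (hc.integrableOn_compact isCompact_Icc).of_forall_sdiff_eq_zero measurableSet_Ioi
    fun r hr => ?_
  simp [radialPart, hv.isBump.apply_div_eq_zero hR hr.2]

/-- Polar coordinates: the angular and the radial variable separate. -/
lemma xi_eq_mellin {v : ℝ → ℝ} (hv : IsCutoff v) {R : ℝ} (hR : 0 < R) (ν : ℝ) (m : ℤ) :
    xi v R ν m = 1 / (2 * Real.pi ^ 2) * mellin (radialPart v R m) (Complex.I * ν) := by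
  rw [xi_eq v hR]
  congr 1
  -- The exponent $i\nu-1$ combines the Jacobian $r$ with the weight $r^{-2}$.
  set G : ℝ × ℝ → ℂ := fun p => (p.1 : ℂ) ^ (Complex.I * ν - 1) * (extendZero v (p.1 / R) *
    (e (2 * (p.1 * Real.cos p.2)) * Complex.exp (m * p.2 * Complex.I))) with hG
  have hGc : ContinuousOn G (Icc (R / 3) (3 * R) ×ˢ Icc (-Real.pi) Real.pi) := fun p hp => by
    refine ContinuousAt.continuousWithinAt ?_
    have h1 : Continuous fun p : ℝ × ℝ => extendZero v (p.1 / R) :=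
      hv.isBump.smooth.continuous.comp (continuous_fst.div_const R)
    have h2 : Continuous fun p : ℝ × ℝ =>
        e (2 * (p.1 * Real.cos p.2)) * Complex.exp (m * p.2 * Complex.I) :=
      (continuous_e.comp (by fun_prop)).mul (by fun_prop)
    exact ((Complex.continuous_ofReal.comp continuous_fst).continuousAt.cpow continuousAt_const
      (ofReal_mem_slitPlane_of_mem_Icc hR hp.1)).mul (h1.mul h2).continuousAt
  have hGi : IntegrableOn G (Ioi 0 ×ˢ Ioo (-Real.pi) Real.pi) := by
    refine (hGc.integrableOn_compact (isCompact_Icc.prod isCompact_Icc)).of_forall_sdiff_eq_zero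
      (measurableSet_Ioi.prod measurableSet_Ioo) fun p hp => ?_
    have : p.1 ∉ Icc (R / 3) (3 * R) := fun h => hp.2 ⟨h, Ioo_subset_Icc_self hp.1.2⟩
    simp [hG, hv.isBump.apply_div_eq_zero hR this]
  rw [← Complex.integral_comp_polarCoord_symm, polarCoord_target]
  calc _ = ∫ p in Ioi 0 ×ˢ Ioo (-Real.pi) Real.pi, G p := by
        refine setIntegral_congr_fun (measurableSet_Ioi.prod measurableSet_Ioo) fun p hp => ?_
        have hp0 : 0 < p.1 := hp.1
        have hp1 : (p.1 : ℂ) ≠ 0 := by exact_mod_cast hp0.ne'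
        have hs : Complex.polarCoord.symm p = p.1 * Complex.exp (p.2 * Complex.I) := by
          rw [Complex.polarCoord_symm_apply, Complex.exp_mul_I, Complex.ofReal_cos,
            Complex.ofReal_sin]
        simp only [hs, osc_polar ν m hp0, hG]
        rw [norm_mul, Complex.norm_exp_ofReal_mul_I, Complex.norm_real, Real.norm_of_nonneg hp0.le,
          mul_one, Complex.cpow_sub _ _ hp1, Complex.cpow_one, Complex.real_smul]
        field_simp
    _ = ∫ r in Ioi (0 : ℝ), ∫ θ in Ioo (-Real.pi) Real.pi, G (r, θ) := by
        rw [Measure.volume_eq_prod] at hGi ⊢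
        exact setIntegral_prod G hGi
    _ = mellin (radialPart v R m) (Complex.I * ν) := by
        rw [mellin]
        congr 1
        ext r
        simp only [hG]
        rw [integral_const_mul, integral_const_mul, ← integral_Ioc_eq_integral_Ioo,
          ← intervalIntegral.integral_of_le (by linarith [Real.pi_pos])]
        rfl

lemma integrable_xi {v : ℝ → ℝ} (hv : IsCutoff v) {R : ℝ} (hR : 1 < R) (m : ℤ) :
    Integrable fun ν => xi v R ν m := by
  obtain ⟨K, hK⟩ := exists_norm_xi_le hv hR
  refine ((integrable_inv_one_add_sq.mul_const ((1 + (m : ℝ) ^ 2)⁻¹)).const_mul K).mono'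
    (continuous_xi hv (by linarith) m).aestronglyMeasurable (.of_forall fun ν => hK ν m)

/-- Mellin inversion on the line $\operatorname{Re}s=0$. The constant is $\frac1{2\pi}$: inversion
gives $\frac1{2\pi}\cdot2\pi^2=\pi$ times the integral over $y=2\nu$, and $d\nu=dy/2$. -/
lemma integral_xi_mul_cpow {v : ℝ → ℝ} (hv : IsCutoff v) {R : ℝ} (hR : 1 < R) (m : ℤ) {r : ℝ}
    (hr : 0 < r) : ∫ ν : ℝ, xi v R (2 * ν) m * (r : ℂ) ^ (-(2 * Complex.I * (ν : ℂ))) =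
      1 / (2 * Real.pi) * radialPart v R m r := by
  have hR0 : 0 < R := by linarith
  have hpi : (Real.pi : ℂ) ≠ 0 := by exact_mod_cast Real.pi_ne_zero
  have hmel (y : ℝ) : mellin (radialPart v R m) ((0 : ℝ) + y * Complex.I) =
      2 * Real.pi ^ 2 * xi v R y m := by
    rw [xi_eq_mellin hv hR0, Complex.ofReal_zero, zero_add, mul_comm (y : ℂ)]
    field_simp
  have hvert : Complex.VerticalIntegrable (mellin (radialPart v R m)) 0 := by
    rw [Complex.VerticalIntegrable]
    simp_rw [hmel]
    exact (integrable_xi hv hR m).const_mul _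
  have hinv := mellinInv_mellin_eq 0 (radialPart v R m) hr
    (hv.mellinConvergent_radialPart hR0 m _) hvert (hv.continuous_radialPart R m).continuousAt
  have hscale := Measure.integral_comp_mul_left
    (fun y : ℝ => xi v R y m * (r : ℂ) ^ (-(Complex.I * (y : ℂ)))) 2
  have h1 : mellinInv 0 (mellin (radialPart v R m)) r = 1 / (2 * Real.pi) * (2 * Real.pi ^ 2 *
      ∫ y : ℝ, xi v R y m * (r : ℂ) ^ (-(Complex.I * (y : ℂ)))) := by
    rw [mellinInv]
    simp_rw [hmel]
    rw [← integral_const_mul, Complex.real_smul]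
    push_cast
    congr 2
    ext y
    rw [zero_add, smul_eq_mul, mul_comm (y : ℂ)]
    ring
  rw [← hinv, h1]
  calc _ = ∫ x : ℝ, xi v R (2 * x) m * (r : ℂ) ^ (-(Complex.I * ((2 * x : ℝ) : ℂ))) := by
        congr 1
        ext ν
        push_cast
        ring_nf
    _ = _ := by
        rw [hscale, Complex.real_smul, abs_of_pos (by norm_num)]
        push_cast
        field_simp

/-- Fourier series of `θ ↦ e(2 r cos θ)`. -/
lemma hasSum_angularIntegral {r θ : ℝ}
    (h : Summable fun m : ℤ => ‖angularIntegral m r‖) :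
    HasSum (fun m : ℤ => 1 / (2 * Real.pi) * angularIntegral m r *
      Complex.exp (-(m * θ * Complex.I))) (e (2 * (r * Real.cos θ))) := by
  have : Fact (0 < 2 * Real.pi) := ⟨Real.two_pi_pos⟩
  have hpi : (Real.pi : ℂ) ≠ 0 := by exact_mod_cast Real.pi_ne_zero
  set f : C(AddCircle (2 * Real.pi), ℂ) :=
    ⟨fun x => e (2 * (r * (AddCircle.toCircle x : ℂ).re)), continuous_e.comp
      (continuous_const.mul (continuous_const.mul (Complex.continuous_re.comp
        (continuous_subtype_val.comp AddCircle.continuous_toCircle))))⟩ with hf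
  have hfx (x : ℝ) : f (x : AddCircle (2 * Real.pi)) = e (2 * (r * Real.cos x)) := by
    simp only [hf, ContinuousMap.coe_mk, AddCircle.toCircle_apply_mk]
    rw [div_self Real.two_pi_pos.ne', one_mul, Circle.coe_exp, Complex.exp_ofReal_mul_I_re]
  -- The sign flips because `angularIntegral` pairs with $e^{im\theta}$, whereas the Fourier
  -- coefficient pairs with the conjugate.
  have hcoef (m : ℤ) : fourierCoeff f (-m) = 1 / (2 * Real.pi) * angularIntegral m r := by
    rw [fourierCoeff_eq_intervalIntegral f (-m) (-Real.pi), angularIntegral, Complex.real_smul,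
      show -Real.pi + 2 * Real.pi = Real.pi by ring]
    push_cast
    congr 1
    refine intervalIntegral.integral_congr fun x _ => ?_
    simp only [neg_neg, fourier_coe_apply, hfx, smul_eq_mul]
    rw [mul_comm]
    congr 2
    push_cast
    field_simp
  have hsum : Summable (fourierCoeff f) := by
    rw [← (Equiv.neg ℤ).summable_iff]
    refine Summable.of_norm ?_
    simp only [Function.comp_def, Equiv.neg_apply, hcoef, norm_mul]
    exact h.mul_left _
  have h1 := has_pointwise_sum_fourier_series_of_summable hsum (θ : AddCircle (2 * Real.pi))
  rw [← (Equiv.neg ℤ).hasSum_iff, hfx] at h1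
  refine h1.congr_fun fun m => ?_
  simp only [Function.comp_def, Equiv.neg_apply, hcoef, fourier_coe_apply, smul_eq_mul]
  congr 2
  push_cast
  field_simp

theorem e_eq_integral_xi {v : ℝ → ℝ} (hv : IsCutoff v) {R : ℝ} (hR : 1 < R) {z : ℂ}
    (hz : ‖z‖ ∈ Icc (R / 2) (2 * R)) :
    e (2 * z.re) = ∫ p : ℝ × ℤ, xi v R (2 * p.1) p.2 *
      (starRingEnd ℂ) (char p.1 p.2 z) ∂dualMeasure := by
  have hR0 : 0 < R := by linarith
  have hr : 0 < ‖z‖ := by linarith [hz.1]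
  have hz0 : z ≠ 0 := norm_pos_iff.1 hr
  have hrc : (‖z‖ : ℂ) ≠ 0 := by exact_mod_cast hr.ne'
  have hw : extendZero v (‖z‖ / R) = 1 := by
    rw [extendZero, if_pos (by positivity), hv.eq_one, Complex.ofReal_one]
    exact ⟨by rw [le_div_iff₀ hR0]; linarith [hz.1], by rw [div_le_iff₀ hR0]; exact hz.2⟩
  have hre : z.re = ‖z‖ * Real.cos z.arg := (Complex.norm_mul_cos_arg z).symm
  have hchar (ν : ℝ) (m : ℤ) : (starRingEnd ℂ) (char ν m z) =
      (‖z‖ : ℂ) ^ (-(2 * Complex.I * (ν : ℂ))) * Complex.exp (-(m * z.arg * Complex.I)) := by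
    have hu : z / ‖z‖ = Complex.exp (z.arg * Complex.I) := by
      rw [div_eq_iff hrc, mul_comm, Complex.norm_mul_exp_arg_mul_I]
    rw [char, hu, ← Complex.exp_int_mul, map_mul, ← Complex.exp_conj,
      Complex.cpow_def_of_ne_zero hrc, Complex.cpow_def_of_ne_zero hrc, ← Complex.exp_conj,
      ← Complex.ofReal_log hr.le]
    congr 2
    · simp [map_ofNat (starRingEnd ℂ) 2]
    · simp
      ring
  have hi := integrable_xi_mul_conj_char hv hR hz0
  have hint (m : ℤ) : ∫ ν : ℝ, xi v R (2 * ν) m * (starRingEnd ℂ) (char ν m z) =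
      1 / (2 * Real.pi) * angularIntegral m ‖z‖ * Complex.exp (-(m * z.arg * Complex.I)) := by
    simp_rw [hchar, ← mul_assoc]
    rw [integral_mul_const, integral_xi_mul_cpow hv hR m hr, radialPart, hw, one_mul]
  rw [dualMeasure] at hi ⊢
  have hright := hi.integral_prod_right
  simp only [hint] at hright
  -- No separate bound on the angular integrals is needed: integrating out $\nu$ by Fubini leaves an
  -- integrable function of $m$ whose modulus is theirs up to $1/(2\pi)$.
  have hsum : Summable fun m : ℤ => ‖angularIntegral m ‖z‖‖ := by
    refine ((integrable_count_iff.1 hright).mul_left (2 * Real.pi)).congr fun m => ?_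
    rw [norm_mul, norm_mul, show -(m * z.arg * Complex.I) =
      ((-(m * z.arg) : ℝ) : ℂ) * Complex.I by push_cast; ring, Complex.norm_exp_ofReal_mul_I]
    simp [abs_of_pos Real.pi_pos]
    field_simp
  rw [integral_prod_symm _ hi]
  simp only [hint]
  rw [integral_countable hright, hre]
  simp only [measureReal_def, Measure.count_singleton, ENNReal.toReal_one, one_smul]
  exact (hasSum_angularIntegral hsum).tsum_eq.symm

end ComplexMellin

theorem mainTheorem7 (v : ℝ → ℝ) (hv : ComplexMellin.IsCutoff v) :
    ∃ c₁ c₂ : ℝ, 0 < c₁ ∧ c₁ < c₂ ∧ ∀ R₀ : ℝ, 1 < R₀ →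
      (∀ R : ℝ, R₀ ≤ R → ∀ z : ℂ, ‖z‖ ∈ Set.Icc (R / 2) (2 * R) →
        MeasureTheory.Integrable
          (fun p : ℝ × ℤ => ComplexMellin.xi v R (2 * p.1) p.2 *
            (starRingEnd ℂ) (ComplexMellin.char p.1 p.2 z)) ComplexMellin.dualMeasure ∧
        ComplexMellin.e (2 * z.re) =
          ∫ p : ℝ × ℤ, ComplexMellin.xi v R (2 * p.1) p.2 *
            (starRingEnd ℂ) (ComplexMellin.char p.1 p.2 z) ∂ComplexMellin.dualMeasure) ∧
      (∀ A : ℝ, ∃ C : ℝ, ∀ R : ℝ, R₀ ≤ R → ∀ (ν : ℝ) (m : ℤ),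
        Real.sqrt (ν ^ 2 + (m : ℝ) ^ 2) ∉ Set.Icc (c₁ * R) (c₂ * R) →
          ‖ComplexMellin.xi v R ν m‖ ≤ C * (R + |ν| + |(m : ℝ)|) ^ (-A)) ∧
      (∃ C : ℝ, ∀ R : ℝ, R₀ ≤ R → ∀ (ν : ℝ) (m : ℤ),
        Real.sqrt (ν ^ 2 + (m : ℝ) ^ 2) ∈ Set.Icc (c₁ * R) (c₂ * R) →
          ‖ComplexMellin.xi v R ν m‖ ≤ C * (Real.log R / R)) := by
  have hpi := Real.pi_pos
  -- The zero of the phase lies in the annulus exactly when $\sqrt{\nu^2+m^2}\in[\frac{4\pi}3R,12\pi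
  -- R]$; the constants halve and double these endpoints.
  refine ⟨2 * Real.pi / 3, 24 * Real.pi, by positivity, by linarith, fun R₀ hR₀ =>
    ⟨fun R hR z hz => ?_, ComplexMellin.exists_norm_xi_le_rpow hv hR₀, ?_⟩⟩
  · have hR1 : 1 < R := hR₀.trans_le hR
    have hz0 : z ≠ 0 := norm_pos_iff.1 (by linarith [hz.1])
    exact ⟨ComplexMellin.integrable_xi_mul_conj_char hv hR1 hz0,
      ComplexMellin.e_eq_integral_xi hv hR1 hz⟩
  · obtain ⟨C, hC⟩ := ComplexMellin.exists_norm_xi_le_log_div hv hR₀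
    exact ⟨C, fun R hR ν m h => hC R hR ν m h.2⟩
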